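/- Let $\Gamma$ be a discrete group and let $Y\subset\Gamma$ be a finite set with $|Y|=q+1$ elements, where $q\ge 1$. For $a$ in the group ring $\mathbb{C}\Gamma$ let $\|a\|=\|\lambda(a)\|_{B(\ell^2(\Gamma))}$, where $\lambda$ is the left regular representation, $(\lambda(x)f)(y)=f(x^{-1}y)$, extended linearly to $\mathbb{C}\Gamma$; let $\tau(a)=\langle\lambda(a)\delta_e,\delta_e\rangle$ and $\|a\|_2=\tau(a^*a)^{1/2}$. Let $h=\sum_{s\in Y}s\in\mathbb{C}\Gamma$. For $n\ge 1$ let $$E_n=\{(s_1,\dots,s_n)\in Y^n : s_i\ne s_{i+1}\ (1\le i\le n-1)\},\qquad \tilde E_n=\{(s_1,\dots,s_n)\in E_n : s_1\ne s_n\},$$ $$h_n=\sum_{(s_1,\dots,s_n)\in E_n}s_1^{-1}s_2\cdots s_{n-1}^{-1}s_n\ \ (n\text{ even}),\qquad h_n=\sum_{(s_1,\dots,s_n)\in E_n}s_1s_2^{-1}s_3\cdots s_{n-1}^{-1}s_n\ \ (n\text{ odd}),$$ $$z_n=\sum_{(s_1,\dots,s_{2n})\in\tilde E_{2n}}s_1^{-1}s_2\cdots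 s_{2n-1}^{-1}s_{2n},$$ $$\xi_n=\|h_n\|_2^2-(q+1)q^{n-1},\qquad \eta_n=\tau(h_{2n}),\qquad \zeta_n=\tau(z_n).$$ The set $Y$ is called a Leinert set if $s_1^{-1}s_2\cdots s_{2n-1}^{-1}s_{2n}\ne e$ for all $n\ge 1$ and all $(s_1,\dots,s_{2n})\in E_{2n}$. Put $$\gamma=\tfrac12\Bigl(\|h\|+\sqrt{\|h\|^2-4q}\Bigr).$$ Then $$\sqrt q\le\gamma\le q\qquad\text{and}\qquad \gamma+\frac q\gamma=\|h\|.$$ If moreover $Y$ is not a Leinert set and $q\ge 2$, then $\gamma>\sqrt q$ and $$\gamma=\lim_{n\to\infty}\|h_n\|_2^{1/n}=\lim_{n\to\infty}\xi_n^{1/(2n)}=\lim_{n\to\infty}\eta_n^{1/(2n)}=\lim_{n\to\infty}\zeta_n^{1/(2n)}.$$ -/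

import Mathlib

open Filter Topology

noncomputable section

namespace Cogrowth

variable {Γ : Type*} [Group Γ]

/-- The Hilbert space `ℓ²(Γ)` of complex-valued square-summable functions on `Γ`. -/
abbrev L2 (Γ : Type*) : Type _ := lp (fun _ : Γ => ℂ) 2

/-- Left translates of square-summable functions are square-summable. -/
theorem memℓp_translate (x : Γ) (f : L2 Γ) :
    Memℓp (fun y : Γ => (f : Γ → ℂ) (x⁻¹ * y)) 2 := by
  have hp : 0 < (2 : ENNReal).toReal := by norm_num
  have hf := (memℓp_gen_iff hp).1 (lp.memℓp f)
  exact (memℓp_gen_iff hp).2 ((Equiv.mulLeft x⁻¹).summable_iff.2 hf)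

/-- The isometry `λ(x)` of `ℓ²(Γ)`, given by `(λ(x) f)(y) = f (x⁻¹ y)`. -/
def translate (x : Γ) : L2 Γ →ₗᵢ[ℂ] L2 Γ where
  toFun f := ⟨fun y => (f : Γ → ℂ) (x⁻¹ * y), memℓp_translate x f⟩
  map_add' _ _ := rfl
  map_smul' _ _ := rfl
  norm_map' f := by
    have hp : 0 < (2 : ENNReal).toReal := by norm_num
    rw [lp.norm_eq_tsum_rpow hp, lp.norm_eq_tsum_rpow hp]
    congr 1
    exact (Equiv.mulLeft x⁻¹).tsum_eq (fun y => ‖(f : Γ → ℂ) y‖ ^ (2 : ENNReal).toReal)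

/-- The left regular representation of `Γ` by bounded operators on `ℓ²(Γ)`. -/
def leftRegularRep (Γ : Type*) [Group Γ] : Γ →* (L2 Γ →L[ℂ] L2 Γ) where
  toFun x := (translate x).toContinuousLinearMap
  map_one' := by
    ext f y
    change (f : Γ → ℂ) (1⁻¹ * y) = (f : Γ → ℂ) y
    simp
  map_mul' a b := by
    ext f y
    change (f : Γ → ℂ) ((a * b)⁻¹ * y) = (f : Γ → ℂ) (b⁻¹ * (a⁻¹ * y))
    simp [mul_assoc]

/-- The extension `λ` of the left regular representation to the complex group ring `ℂΓ`. -/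
def regularRep (Γ : Type*) [Group Γ] : MonoidAlgebra ℂ Γ →ₐ[ℂ] (L2 Γ →L[ℂ] L2 Γ) :=
  MonoidAlgebra.lift ℂ (L2 Γ →L[ℂ] L2 Γ) Γ (leftRegularRep Γ)

/-- The norm `‖a‖ = ‖λ(a)‖` of an element of the group ring: the operator norm on `ℓ²(Γ)`. -/
def opNorm (a : MonoidAlgebra ℂ Γ) : ℝ := ‖regularRep Γ a‖

open Classical in
/-- The vector `δ_e` of `ℓ²(Γ)`. -/
def deltaOne (Γ : Type*) [Group Γ] : L2 Γ := lp.single 2 (1 : Γ) (1 : ℂ)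

/-- The functional `τ(T) = ⟨T δ_e, δ_e⟩` (Mathlib's `inner` is linear in its second argument). -/
def trace (T : L2 Γ →L[ℂ] L2 Γ) : ℂ := inner ℂ (deltaOne Γ) (T (deltaOne Γ))

/-- The 2-norm `‖a‖₂ = τ(a* a)^{1/2}` of an element of the group ring; the trace of the positive
operator `λ(a)* λ(a)` is a nonnegative real number. -/
def twoNorm (a : MonoidAlgebra ℂ Γ) : ℝ :=
  √(trace (ContinuousLinearMap.adjoint (regularRep Γ a) * regularRep Γ a)).re

open Classical in
/-- `E_n`: the tuples `(s_1, …, s_n)` in `Y ^ n` with `s_1 ≠ s_2 ≠ ⋯ ≠ s_n`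
(consecutive entries are distinct). -/
def words (Y : Finset Γ) (n : ℕ) : Finset (Fin n → Γ) :=
  (Fintype.piFinset fun _ => Y).filter fun s =>
    ∀ (i : ℕ) (hi : i + 1 < n), s ⟨i, Nat.lt_of_succ_lt hi⟩ ≠ s ⟨i + 1, hi⟩

open Classical in
/-- The cyclic version of `E_n`: the tuples in `E_n` with moreover `s_1 ≠ s_n`. -/
def cyclicWords (Y : Finset Γ) (n : ℕ) : Finset (Fin n → Γ) :=
  (words Y n).filter fun s =>
    ∀ hn : 0 < n, s ⟨0, hn⟩ ≠ s ⟨n - 1, Nat.sub_lt hn Nat.one_pos⟩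

/-- The alternating product, in which the last factor is `s_n`, the one before it `s_{n-1}⁻¹`, and
so on: `s_1⁻¹ s_2 ⋯ s_{n-1}⁻¹ s_n` for `n` even, and `s_1 s_2⁻¹ s_3 ⋯ s_{n-1}⁻¹ s_n` for `n` odd. -/
def altProd {n : ℕ} (s : Fin n → Γ) : Γ :=
  (List.ofFn fun i => if Even (i.rev : ℕ) then s i else (s i)⁻¹).prod

/-- The element `h = ∑_{s ∈ Y} s` of the group ring. -/
def sumElt (Y : Finset Γ) : MonoidAlgebra ℂ Γ := ∑ s ∈ Y, MonoidAlgebra.of ℂ Γ s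

/-- The element `h_n` of the group ring: the sum over `E_n` of the alternating products. -/
def hSeq (Y : Finset Γ) (n : ℕ) : MonoidAlgebra ℂ Γ :=
  ∑ s ∈ words Y n, MonoidAlgebra.of ℂ Γ (altProd s)

/-- The element `z_n` of the group ring: the cyclic version of `h_{2n}`. -/
def zSeq (Y : Finset Γ) (n : ℕ) : MonoidAlgebra ℂ Γ :=
  ∑ s ∈ cyclicWords Y (2 * n), MonoidAlgebra.of ℂ Γ (altProd s)

/-- `ξ_n = ‖h_n‖₂² - (q + 1) q^{n-1}` with `q + 1 = |Y|` (for `n ≥ 1`, and `Y` non-empty). -/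
def xi (Y : Finset Γ) (n : ℕ) : ℝ :=
  twoNorm (hSeq Y n) ^ 2 - (Y.card : ℝ) * ((Y.card : ℝ) - 1) ^ (n - 1)

/-- `η_n = τ(h_{2n})`. This trace is the number of tuples in `E_{2n}` with alternating product `e`,
so that taking the real part loses nothing. -/
def eta (Y : Finset Γ) (n : ℕ) : ℝ := (trace (regularRep Γ (hSeq Y (2 * n)))).re

/-- `ζ_n = τ(z_n)`. This trace is the number of cyclic tuples of length `2n` with alternating
product `e`, so that taking the real part loses nothing. -/
def zeta (Y : Finset Γ) (n : ℕ) : ℝ := (trace (regularRep Γ (zSeq Y n))).re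

/-- `Y` is a Leinert set if `s_1⁻¹ s_2 ⋯ s_{2n-1}⁻¹ s_{2n} ≠ e` for all `n ≥ 1` and all
`(s_1, …, s_{2n})` in `E_{2n}`. -/
def IsLeinert (Y : Finset Γ) : Prop :=
  ∀ n : ℕ, 1 ≤ n → ∀ s ∈ words Y (2 * n), altProd s ≠ 1

end Cogrowth

end

/-! The elements `h_{2n}` satisfy a three-term recursion in `h* h`, and `z_n` has, up to the
constant `q - 1`, the trace of the Dickson polynomial `D_n` of `h* h`, where
`D_n ((u + v) ^ 2) = u ^ (2 n) + v ^ (2 n)` if `u v = q`. The growth of `D_n` on the spectrum is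
governed by its value at the top `‖h‖² = (γ + q / γ)²`, and as `δ_e` is separating for the operators
`λ(a)`, the trace detects the top of the spectrum: `ζ_n` grows at least like `u ^ (2 n)` for each
`u < γ`. Since `ζ_n ≤ η_n ≤ ξ_n ≤ ‖h_n‖₂² ≤ ‖h_n‖²`, and the recursion bounds `‖h_n‖` by a
polynomial multiple of `γ ^ n`, all the limits are `γ`.

Moments with nonnegative coefficients can only grow under the projection from the free group on `Y`,
where truncated spherical functions of the tree are approximate eigenvectors of `h* h` at `4 q`;
hence `‖h‖² ≥ 4 q`. If a word is trivial in `Γ`, perturbing `(h* h)^m` in the free group by this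
word raises the top of the spectrum by first-order perturbation theory, and hence `‖h‖² > 4 q`. -/

noncomputable section

namespace Cogrowth

open scoped Classical Pointwise

section ReducedWords

variable {α β : Type*} {Y : Finset α} {q m n : ℕ} {a : α} {l l' : List α}

/-- The words of `words Y n`, encoded as lists so as to allow induction on the word. -/
def listWords (Y : Finset α) (n : ℕ) : Finset (List α) := (words Y n).image List.ofFn

theorem mem_listWords :
    l ∈ listWords Y n ↔ l.length = n ∧ (∀ x ∈ l, x ∈ Y) ∧ l.IsChain (· ≠ ·) := by
  simp only [listWords, Finset.mem_image, words, Finset.mem_filter, Fintype.mem_piFinset]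
  constructor
  · rintro ⟨s, ⟨hs, hchain⟩, rfl⟩
    exact ⟨List.length_ofFn, List.forall_mem_ofFn_iff.2 hs, List.isChain_ofFn.2 hchain⟩
  · rintro ⟨rfl, hY, hchain⟩
    rw [← List.ofFn_get l] at hchain
    exact ⟨l.get, ⟨fun i => hY _ (List.get_mem l i), List.isChain_ofFn.1 hchain⟩, List.ofFn_get l⟩

theorem length_of_mem_listWords (hl : l ∈ listWords Y n) : l.length = n := (mem_listWords.1 hl).1

theorem sum_listWords {A : Type*} [AddCommMonoid A] (Y : Finset α) (n : ℕ) (F : List α → A) :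
    ∑ l ∈ listWords Y n, F l = ∑ s ∈ words Y n, F (List.ofFn s) :=
  Finset.sum_image fun _ _ _ _ h => List.ofFn_injective h

theorem listWords_zero (Y : Finset α) : listWords Y 0 = {[]} := by
  ext l
  simp +contextual [mem_listWords, iff_def]

theorem cons_mem_listWords :
    a :: l ∈ listWords Y (n + 1) ↔ a ∈ Y ∧ l ∈ listWords Y n ∧ l.head? ≠ some a := by
  cases l with
  | nil => simp [mem_listWords, and_comm, eq_comm]
  | cons b l =>
    simp only [mem_listWords, List.length_cons, List.mem_cons, List.isChain_cons_cons,
      List.head?_cons, ne_eq, Option.some.injEq]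
    grind

theorem reverse_mem_listWords : l.reverse ∈ listWords Y n ↔ l ∈ listWords Y n := by
  simp only [mem_listWords, List.length_reverse, List.mem_reverse, List.isChain_reverse, ne_comm]

theorem append_singleton_mem_listWords :
    l ++ [a] ∈ listWords Y (n + 1) ↔ a ∈ Y ∧ l ∈ listWords Y n ∧ l.getLast? ≠ some a := by
  rw [← reverse_mem_listWords, List.reverse_append, List.reverse_singleton, List.singleton_append,
    cons_mem_listWords, reverse_mem_listWords, List.head?_reverse]

theorem append_mem_listWords (hl : l.length = m) (hl' : l'.length = n) :
    l ++ l' ∈ listWords Y (m + n) ↔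
      l ∈ listWords Y m ∧ l' ∈ listWords Y n ∧ ∀ a ∈ l.getLast?, ∀ b ∈ l'.head?, a ≠ b := by
  simp only [mem_listWords, List.length_append, List.mem_append, List.isChain_append, hl, hl']
  grind

theorem map_mem_listWords_map {f : α ↪ β} :
    l.map f ∈ listWords (Y.map f) n ↔ l ∈ listWords Y n := by
  simp only [mem_listWords, List.length_map, List.forall_mem_map, Finset.mem_map',
    List.isChain_map, f.injective.ne_iff]

theorem sum_listWords_succ {A : Type*} [AddCommMonoid A] (Y : Finset α) (n : ℕ)
    (F : List α → A) :
    ∑ l ∈ listWords Y (n + 1), F l =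
      ∑ a ∈ Y, ∑ l ∈ listWords Y n with l.head? ≠ some a, F (a :: l) := by
  rw [Finset.sum_sigma']
  refine (Finset.sum_bij (fun p _ => p.1 :: p.2) ?_ ?_ ?_ fun _ _ => rfl).symm
  · rintro ⟨a, l⟩ h
    simpa [cons_mem_listWords] using h
  · rintro ⟨a, l⟩ _ ⟨b, l'⟩ _ h
    simpa using h
  · intro l hl
    cases l with
    | nil => simp [mem_listWords] at hl
    | cons a l => exact ⟨⟨a, l⟩, by simpa using cons_mem_listWords.1 hl, rfl⟩

theorem sum_sum_cons_listWords {A : Type*} [AddCommMonoid A] (Y : Finset α) (n : ℕ)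
    (F : List α → A) :
    ∑ a ∈ Y, ∑ l ∈ listWords Y (n + 1), F (a :: l) =
      ∑ l ∈ listWords Y (n + 2), F l +
        ∑ l ∈ listWords Y n, ∑ a ∈ Y with l.head? ≠ some a, F (a :: a :: l) := by
  have sum_head_eq : ∀ a ∈ Y, (∑ l ∈ listWords Y (n + 1) with ¬l.head? ≠ some a, F (a :: l)) =
      ∑ l ∈ listWords Y n with l.head? ≠ some a, F (a :: a :: l) := by
    intro a ha
    rw [Finset.sum_filter, sum_listWords_succ, Finset.sum_eq_single_of_mem a ha]
    · simp
    · intro b _ hb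
      simp [hb]
  calc
    _ = ∑ a ∈ Y, (∑ l ∈ listWords Y (n + 1) with l.head? ≠ some a, F (a :: l) +
          ∑ l ∈ listWords Y (n + 1) with ¬l.head? ≠ some a, F (a :: l)) := by
      simp only [Finset.sum_filter_add_sum_filter_not]
    _ = _ := by
      rw [Finset.sum_add_distrib, ← sum_listWords_succ, Finset.sum_congr rfl sum_head_eq]
      simp_rw [Finset.sum_filter]
      rw [Finset.sum_comm]

theorem card_filter_head?_ne (hY : Y.card = q + 1) (hl : l ∈ listWords Y (n + 1)) :
    {a ∈ Y | l.head? ≠ some a}.card = q := by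
  obtain ⟨b, l, rfl⟩ := List.exists_cons_of_length_eq_add_one (length_of_mem_listWords hl)
  simp [Finset.filter_ne, (cons_mem_listWords.1 hl).1, hY]

theorem card_listWords_filter_head?_ne (hY : Y.card = q + 1) (n : ℕ) (ha : a ∈ Y) :
    {l ∈ listWords Y n | l.head? ≠ some a}.card = q ^ n := by
  induction n generalizing a with
  | zero => simp [listWords_zero, Finset.filter_singleton]
  | succ n ih =>
    have card_cons : ∀ b ∈ Y, (∑ l ∈ listWords Y n with l.head? ≠ some b,
        if (b :: l).head? ≠ some a then 1 else 0) = if b ≠ a then q ^ n else 0 := by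
      intro b hb
      by_cases hba : b = a
      · simp [hba]
      · simpa [hba] using ih hb
    rw [Finset.card_filter, sum_listWords_succ, Finset.sum_congr rfl card_cons,
      ← Finset.sum_filter, Finset.sum_const, Finset.filter_ne', Finset.card_erase_of_mem ha, hY,
      smul_eq_mul, pow_succ', Nat.add_sub_cancel]

theorem card_listWords_succ (hY : Y.card = q + 1) (n : ℕ) :
    (listWords Y (n + 1)).card = (q + 1) * q ^ n := by
  rw [Finset.card_eq_sum_ones, sum_listWords_succ, Finset.sum_congr rfl fun a ha =>
    (Finset.card_eq_sum_ones _).symm.trans (card_listWords_filter_head?_ne hY n ha)]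
  simp [hY]

end ReducedWords

section AlternatingProducts

variable {Γ Λ : Type*} [Group Γ] [Group Λ] {Y : Finset Γ} {m n : ℕ} {l l' : List Γ}

/-- The alternating product `altProd` of a word encoded as a list: the last letter is not inverted,
the one before it is, and so on. -/
def altListProd : List Γ → Γ
  | [] => 1
  | a :: l => (if Even l.length then a else a⁻¹) * altListProd l

theorem altListProd_ofFn (s : Fin n → Γ) : altListProd (List.ofFn s) = altProd s := by
  induction n with
  | zero => simp [altProd, altListProd]
  | succ n ih =>
    rw [List.ofFn_succ, altListProd, ih fun i => s i.succ]
    simp only [altProd, List.ofFn_succ, List.prod_cons, List.length_ofFn, Fin.rev_zero,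
      Fin.val_last, Fin.rev_succ, Fin.val_castSucc]

theorem altListProd_cons_of_even (h : Even l.length) (a : Γ) :
    altListProd (a :: l) = a * altListProd l := by simp [altListProd, h]

theorem altListProd_cons_of_odd (h : Odd l.length) (a : Γ) :
    altListProd (a :: l) = a⁻¹ * altListProd l := by simp [altListProd, h]

theorem altListProd_map (f : Γ →* Λ) (l : List Γ) :
    altListProd (l.map f) = f (altListProd l) := by
  induction l with
  | nil => simp [altListProd]
  | cons a l ih =>
    rw [List.map_cons, altListProd, altListProd, ih, List.length_map, map_mul, apply_ite f, map_inv]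

theorem altListProd_append_singleton (l : List Γ) (a : Γ) :
    altListProd (l ++ [a]) = altListProd (l.map (·⁻¹)) * a := by
  induction l with
  | nil => simp [altListProd]
  | cons b l ih =>
    rcases Nat.even_or_odd l.length with hl | hl <;>
      simp [altListProd, ih, hl, Nat.even_add_one, mul_assoc]

theorem altListProd_cons_append_singleton (hl : Even l.length) (a : Γ) :
    altListProd (a :: (l ++ [a])) = a⁻¹ * altListProd (l.map (·⁻¹)) * a := by
  rw [altListProd_cons_of_odd (by simpa [Nat.odd_add_one]), altListProd_append_singleton, mul_assoc]

theorem inv_altListProd_mul_altListProd (h : Even (l.length + l'.length)) :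
    (altListProd l)⁻¹ * altListProd l' = altListProd (l.reverse ++ l') := by
  induction l generalizing l' with
  | nil => simp [altListProd]
  | cons a l ih =>
    have heven : Even (l.length + (a :: l').length) := by
      simpa [add_assoc, add_comm, add_left_comm] using h
    have hparity : Even l'.length ↔ ¬Even l.length := by
      simp only [List.length_cons] at h
      grind
    rw [List.reverse_cons, List.append_assoc, List.singleton_append, ← ih heven, altListProd,
      altListProd]
    by_cases hl : Even l.length <;> simp [hparity, hl, mul_assoc]

theorem hSeq_eq_sum_listWords (Y : Finset Γ) (n : ℕ) :
    hSeq Y n = ∑ l ∈ listWords Y n, MonoidAlgebra.of ℂ Γ (altListProd l) := by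
  simp only [hSeq, sum_listWords, altListProd_ofFn]

theorem zSeq_eq_sum_listWords (Y : Finset Γ) (hn : n ≠ 0) :
    zSeq Y n = ∑ l ∈ listWords Y (2 * n) with l.head? ≠ l.getLast?,
      MonoidAlgebra.of ℂ Γ (altListProd l) := by
  have hpos : 0 < 2 * n := by lia
  rw [zSeq, cyclicWords, Finset.sum_filter, Finset.sum_filter, sum_listWords]
  refine Finset.sum_congr rfl fun s _ => ?_
  have hlast : 2 * n - 1 < 2 * n := by lia
  simp [altListProd_ofFn, List.head?_eq_getElem?, List.getLast?_eq_getElem?, hpos,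
    hlast]

theorem isLeinert_iff_listWords :
    IsLeinert Y ↔ ∀ n, Even n → ∀ l ∈ listWords Y n, altListProd l = 1 → l = [] := by
  simp only [IsLeinert, listWords, Finset.forall_mem_image, altListProd_ofFn]
  constructor
  · rintro h n hn s hs hprod
    obtain ⟨k, rfl⟩ := even_iff_exists_two_mul.1 hn
    obtain rfl : k = 0 := by
      by_contra hk
      exact h k (by lia) s hs hprod
    exact List.ofFn_zero
  · intro h n hn s hs hprod
    have := congrArg List.length (h (2 * n) (even_two_mul n) hs hprod)
    simp at this
    lia

theorem IsLeinert.eq_nil_of_altListProd_eq (hY : IsLeinert Y) (hl : l ∈ listWords Y m)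
    (hl' : l' ∈ listWords Y n) (heven : Even (m + n)) (h : altListProd l = altListProd l')
    (hhead : ∀ a ∈ l.head?, ∀ b ∈ l'.head?, a ≠ b) : l = [] ∧ l' = [] := by
  have hlen := length_of_mem_listWords hl
  have hlen' := length_of_mem_listWords hl'
  have hmem : l.reverse ++ l' ∈ listWords Y (m + n) :=
    (append_mem_listWords (by simpa using hlen) hlen').2
      ⟨reverse_mem_listWords.2 hl, hl', by simpa using hhead⟩
  have hprod : altListProd (l.reverse ++ l') = 1 := by
    rw [← inv_altListProd_mul_altListProd (by rwa [hlen, hlen']), h, inv_mul_cancel]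
  simpa using isLeinert_iff_listWords.1 hY _ heven _ hmem hprod

theorem IsLeinert.eq_of_altListProd_eq (hY : IsLeinert Y) (hl : l ∈ listWords Y m)
    (hl' : l' ∈ listWords Y n) (heven : Even (m + n)) (h : altListProd l = altListProd l') :
    l = l' := by
  induction l generalizing l' m n with
  | nil => exact (hY.eq_nil_of_altListProd_eq hl hl' heven h (by simp)).2.symm
  | cons a l ih =>
    cases l' with
    | nil => exact (hY.eq_nil_of_altListProd_eq hl hl' heven h (by simp)).1
    | cons b l' =>
      obtain rfl | hab := eq_or_ne a b
      · obtain rfl : l.length + 1 = m := length_of_mem_listWords hl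
        obtain rfl : l'.length + 1 = n := length_of_mem_listWords hl'
        have hparity : Even l.length ↔ Even l'.length := by grind
        simp only [altListProd, hparity, mul_right_inj] at h
        rw [ih (cons_mem_listWords.1 hl).2.1 (cons_mem_listWords.1 hl').2.1 (by grind) h]
      · simpa using hY.eq_nil_of_altListProd_eq hl hl' heven h (by simpa using hab)

end AlternatingProducts

section ClosedWords

variable {Γ : Type*} [Group Γ] {Y : Finset Γ} {q n : ℕ} {a : Γ} {l : List Γ}

/-- The words in `E_{2n}` whose alternating product is `1`; `η_n` counts them. -/
def closedWords (Y : Finset Γ) (n : ℕ) : Finset (List Γ) :=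
  {l ∈ listWords Y (2 * n) | altListProd l = 1}

/-- The closed words whose first and last letters differ; `ζ_n` counts them. -/
def cyclicClosedWords (Y : Finset Γ) (n : ℕ) : Finset (List Γ) :=
  {l ∈ closedWords Y n | l.head? ≠ l.getLast?}

/-- The closed words whose first and last letters agree. -/
def acyclicClosedWords (Y : Finset Γ) (n : ℕ) : Finset (List Γ) :=
  {l ∈ closedWords Y n | ¬l.head? ≠ l.getLast?}

theorem card_cyclicClosedWords_add_card_acyclicClosedWords (Y : Finset Γ) (n : ℕ) :
    (cyclicClosedWords Y n).card + (acyclicClosedWords Y n).card = (closedWords Y n).card :=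
  Finset.card_filter_add_card_filter_not _

theorem closedWords_one (Y : Finset Γ) : closedWords Y 1 = ∅ := by
  refine Finset.filter_eq_empty_iff.2 fun l hl hprod => ?_
  obtain ⟨hlen, -, hchain⟩ := mem_listWords.1 hl
  obtain ⟨a, b, rfl⟩ := List.length_eq_two.1 hlen
  have hab : a ≠ b := by simpa using hchain
  exact hab (by simpa [altListProd, inv_mul_eq_one] using hprod)

theorem getLast?_cons_append_singleton {α : Type*} (a b : α) (l : List α) :
    (a :: (l ++ [b])).getLast? = some b :=
  List.getLast?_concat (l := a :: l)

theorem map_inv_mem_listWords_inv : l.map (·⁻¹) ∈ listWords Y⁻¹ n ↔ l ∈ listWords Y n := by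
  simp only [mem_listWords, List.length_map, List.forall_mem_map, Finset.mem_inv', inv_inv,
    List.isChain_map, inv_injective.ne_iff]

theorem rotate_map_inv_mem_cyclicClosedWords_inv (hl : l ∈ cyclicClosedWords Y n) :
    (l.rotate 1).map (·⁻¹) ∈ cyclicClosedWords Y⁻¹ n := by
  simp only [cyclicClosedWords, closedWords, Finset.mem_filter] at hl ⊢
  obtain ⟨⟨hl, hprod⟩, hne⟩ := hl
  obtain _ | ⟨a, _ | ⟨b, l⟩⟩ := l
  · simp at hne
  · simp at hne
  obtain ⟨k, hk⟩ : ∃ k, 2 * n = k + 1 := ⟨_, (length_of_mem_listWords hl).symm⟩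
  rw [hk] at hl ⊢
  obtain ⟨ha, htail, hab⟩ := cons_mem_listWords.1 hl
  have hodd : Odd (b :: l).length := by
    rw [length_of_mem_listWords htail]
    grind
  have hlast : (b :: l).getLast? ≠ some a := by
    rw [List.head?_cons, List.getLast?_cons_cons] at hne
    exact hne.symm
  rw [List.rotate_cons_succ, List.rotate_zero, map_inv_mem_listWords_inv]
  refine ⟨⟨append_singleton_mem_listWords.2 ⟨ha, htail, hlast⟩, ?_⟩, ?_⟩
  · rw [altListProd_cons_of_odd hodd, inv_mul_eq_one] at hprod
    simp only [List.map_append, List.map_singleton, altListProd_append_singleton, List.map_map,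
      Function.comp_def, inv_inv, List.map_id', ← hprod, mul_inv_cancel]
  · simpa [getLast?_cons_append_singleton] using hab

theorem card_cyclicClosedWords_inv (Y : Finset Γ) (n : ℕ) :
    (cyclicClosedWords Y⁻¹ n).card = (cyclicClosedWords Y n).card := by
  have card_le : ∀ Y : Finset Γ, (cyclicClosedWords Y n).card ≤ (cyclicClosedWords Y⁻¹ n).card :=
    fun _ => Finset.card_le_card_of_injOn (fun l => (l.rotate 1).map (·⁻¹))
      (fun _ => rotate_map_inv_mem_cyclicClosedWords_inv) fun _ _ _ _ h =>
      List.rotate_injective 1 (List.map_injective_iff.2 inv_injective h)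
  exact le_antisymm (by simpa only [inv_inv] using card_le Y⁻¹) (card_le Y)

theorem cons_append_singleton_mem_acyclicClosedWords_succ (hn : n ≠ 0) :
    a :: (l ++ [a]) ∈ acyclicClosedWords Y (n + 1) ↔
      l.map (·⁻¹) ∈ closedWords Y⁻¹ n ∧ a ∈ Y ∧ l.head? ≠ some a ∧ l.getLast? ≠ some a := by
  simp only [acyclicClosedWords, closedWords, Finset.mem_filter, map_inv_mem_listWords_inv,
    mul_add, mul_one]
  have hacyclic : (a :: (l ++ [a])).head? = (a :: (l ++ [a])).getLast? := by
    simp [getLast?_cons_append_singleton]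
  have hhead (hl : l ∈ listWords Y (2 * n)) : (l ++ [a]).head? = l.head? := by
    refine List.head?_append_of_ne_nil _ (List.ne_nil_of_length_pos ?_)
    rw [length_of_mem_listWords hl]
    lia
  have hprod (hl : l ∈ listWords Y (2 * n)) :
      altListProd (a :: (l ++ [a])) = 1 ↔ altListProd (l.map (·⁻¹)) = 1 := by
    rw [altListProd_cons_append_singleton (by simp [length_of_mem_listWords hl]),
      mul_eq_one_iff_eq_inv, mul_eq_left]
  rw [cons_mem_listWords, append_singleton_mem_listWords]
  constructor
  · rintro ⟨⟨⟨ha, ⟨-, hl, hlast⟩, hne⟩, hone⟩, -⟩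
    exact ⟨⟨hl, (hprod hl).1 hone⟩, ha, hhead hl ▸ hne, hlast⟩
  · rintro ⟨⟨hl, hone⟩, ha, hne, hlast⟩
    exact ⟨⟨⟨ha, ⟨ha, hl, hlast⟩, (hhead hl).symm ▸ hne⟩, (hprod hl).2 hone⟩, not_not.2 hacyclic⟩

theorem exists_eq_cons_append_singleton (hl : l ∈ acyclicClosedWords Y n) (hn : n ≠ 0) :
    ∃ a r, l = a :: (r ++ [a]) := by
  simp only [acyclicClosedWords, closedWords, Finset.mem_filter, not_not] at hl
  obtain ⟨⟨hl, -⟩, hacyclic⟩ := hl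
  have hlen := length_of_mem_listWords hl
  obtain _ | ⟨a, l⟩ := l
  · simp at hlen
    lia
  obtain rfl | ⟨r, b, rfl⟩ := l.eq_nil_or_concat'
  · simp at hlen
    lia
  have hab : a = b := by simpa [getLast?_cons_append_singleton] using hacyclic
  exact ⟨a, r, by rw [hab]⟩

-- A closed word which is not cyclic is `a r a` where `r` spells, up to inverting its letters, a
-- shorter closed word; the letter `a` avoids both ends of `r`.
theorem card_acyclicClosedWords_succ (Y : Finset Γ) (hn : n ≠ 0) :
    (acyclicClosedWords Y (n + 1)).card =
      ∑ l ∈ closedWords Y⁻¹ n, {x ∈ Y⁻¹ | l.head? ≠ some x ∧ l.getLast? ≠ some x}.card := by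
  have mem_iff (l : List Γ) (x : Γ) :
      x⁻¹ :: (l.map (·⁻¹) ++ [x⁻¹]) ∈ acyclicClosedWords Y (n + 1) ↔
        l ∈ closedWords Y⁻¹ n ∧ x ∈ Y⁻¹ ∧ l.head? ≠ some x ∧ l.getLast? ≠ some x := by
    simp [cons_append_singleton_mem_acyclicClosedWords_succ hn, Option.map_eq_some_iff]
  rw [← Finset.card_sigma]
  refine (Finset.card_bij (fun p _ => p.2⁻¹ :: (p.1.map (·⁻¹) ++ [p.2⁻¹])) ?_ ?_ ?_).symm
  · rintro ⟨l, x⟩ h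
    simpa only [Finset.mem_sigma, Finset.mem_filter, ← mem_iff] using h
  · rintro ⟨l, x⟩ _ ⟨l', x'⟩ _ h
    obtain ⟨hx, hl⟩ := List.cons.inj h
    obtain rfl : x = x' := inv_injective hx
    obtain rfl : l = l' := List.map_injective_iff.2 inv_injective (List.append_inj_left' hl rfl)
    rfl
  · intro l hl
    obtain ⟨a, r, rfl⟩ := exists_eq_cons_append_singleton hl n.succ_ne_zero
    exact ⟨⟨r.map (·⁻¹), a⁻¹⟩, by
      simpa only [Finset.mem_sigma, Finset.mem_filter, ← mem_iff, List.map_map, inv_inv,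
        Function.comp_def, List.map_id'] using hl, by simp⟩

theorem card_filter_ne_and_ne_add {α : Type*} {Y : Finset α} {q : ℕ} (hY : Y.card = q + 1)
    {a b : α} (ha : a ∈ Y) (hb : b ∈ Y) :
    {x ∈ Y | a ≠ x ∧ b ≠ x}.card + (if a ≠ b then 1 else 0) = q := by
  rw [Finset.filter_and, Finset.filter_ne, Finset.filter_ne, Finset.inter_erase,
    Finset.inter_eq_left.2 (Finset.erase_subset a Y)]
  obtain rfl | hab := eq_or_ne a b
  · simp [ha, hY]
  · have := Finset.card_erase_add_one (Finset.mem_erase.2 ⟨hab.symm, hb⟩)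
    rw [Finset.card_erase_of_mem ha, hY] at this
    simpa [hab] using this

theorem card_acyclicClosedWords_succ_add (hY : Y.card = q + 1) (hn : n ≠ 0) :
    (acyclicClosedWords Y (n + 1)).card + (cyclicClosedWords Y n).card =
      q * (closedWords Y⁻¹ n).card := by
  rw [← card_cyclicClosedWords_inv, card_acyclicClosedWords_succ Y hn, cyclicClosedWords,
    Finset.card_filter, ← Finset.sum_add_distrib, mul_comm, ← smul_eq_mul]
  refine Finset.sum_eq_card_nsmul fun l hl => ?_
  obtain ⟨hlen, hmem, -⟩ := mem_listWords.1 (Finset.mem_filter.1 hl).1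
  have hnil : l ≠ [] := List.ne_nil_of_length_pos (by lia)
  rw [List.head?_eq_some_head hnil, List.getLast?_eq_some_getLast hnil]
  simp only [ne_eq, Option.some.injEq]
  exact card_filter_ne_and_ne_add (by rwa [Finset.card_inv]) (hmem _ (List.head_mem hnil))
    (hmem _ (List.getLast_mem hnil))

theorem card_acyclicClosedWords_inv (hY : Y.card = q + 1) (hn : 1 ≤ n) :
    (acyclicClosedWords Y⁻¹ n).card = (acyclicClosedWords Y n).card := by
  induction n, hn using Nat.le_induction with
  | base => simp [acyclicClosedWords, closedWords_one]
  | succ n hn ih =>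
    have hrec := card_acyclicClosedWords_succ_add hY (Nat.ne_of_gt hn)
    have hrec_inv := card_acyclicClosedWords_succ_add (Y := Y⁻¹) (by rwa [Finset.card_inv])
      (Nat.ne_of_gt hn)
    rw [inv_inv, card_cyclicClosedWords_inv,
      ← card_cyclicClosedWords_add_card_acyclicClosedWords] at hrec_inv
    rw [← card_cyclicClosedWords_add_card_acyclicClosedWords, card_cyclicClosedWords_inv,
      ih] at hrec
    lia

theorem card_closedWords_inv (hY : Y.card = q + 1) (hn : 1 ≤ n) :
    (closedWords Y⁻¹ n).card = (closedWords Y n).card := by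
  simp only [← card_cyclicClosedWords_add_card_acyclicClosedWords, card_cyclicClosedWords_inv,
    card_acyclicClosedWords_inv hY hn]

theorem card_closedWords_succ_add (hY : Y.card = q + 1) (hn : 1 ≤ n) :
    (closedWords Y (n + 1)).card + (cyclicClosedWords Y n).card =
      (cyclicClosedWords Y (n + 1)).card + q * (closedWords Y n).card := by
  rw [← card_cyclicClosedWords_add_card_acyclicClosedWords, add_assoc,
    card_acyclicClosedWords_succ_add hY (Nat.ne_of_gt hn), card_closedWords_inv hY hn]

theorem take_drop_of_mem_closedWords (hl : l ∈ closedWords Y n) (hn : n ≠ 0) :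
    (l.take n).reverse ∈ listWords Y n ∧ l.drop n ∈ listWords Y n ∧
      altListProd (l.take n).reverse = altListProd (l.drop n) ∧
      (l.take n).reverse ≠ l.drop n := by
  obtain ⟨hl, hprod⟩ := Finset.mem_filter.1 hl
  have hlen := length_of_mem_listWords hl
  have htake : (l.take n).length = n := by
    rw [List.length_take]
    lia
  have hdrop : (l.drop n).length = n := by
    rw [List.length_drop]
    lia
  rw [two_mul, ← l.take_append_drop n, append_mem_listWords htake hdrop] at hl
  obtain ⟨hmem_take, hmem_drop, hcut⟩ := hl
  refine ⟨reverse_mem_listWords.2 hmem_take, hmem_drop, ?_, fun heq => ?_⟩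
  · rw [← inv_mul_eq_one, inv_altListProd_mul_altListProd (by simp [htake, hdrop]),
      List.reverse_reverse, List.take_append_drop, hprod]
  · obtain ⟨b, t, hbt⟩ := List.exists_cons_of_ne_nil
      (List.ne_nil_of_length_pos (by lia : 0 < (l.drop n).length))
    refine hcut b ?_ b (by simp [hbt]) rfl
    rw [← List.head?_reverse, heq, hbt]
    rfl

theorem card_closedWords_add_card_listWords_le (Y : Finset Γ) (hn : n ≠ 0) :
    (closedWords Y n).card + (listWords Y n).card ≤
      {p ∈ listWords Y n ×ˢ listWords Y n | altListProd p.1 = altListProd p.2}.card := by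
  rw [← Finset.card_filter_add_card_filter_not (s := {p ∈ listWords Y n ×ˢ listWords Y n | _})
    fun p => p.1 ≠ p.2]
  refine add_le_add
    (Finset.card_le_card_of_injOn (fun l => ((l.take n).reverse, l.drop n)) (fun l hl => ?_)
      fun l _ l' _ h => ?_)
    (Finset.card_le_card_of_injOn (fun l => (l, l)) (by simp [Set.MapsTo]) (by simp [Set.InjOn]))
  · obtain ⟨htake, hdrop, hprod, hne⟩ := take_drop_of_mem_closedWords hl hn
    simp [htake, hdrop, hprod, hne]
  · simp only [Prod.mk.injEq, List.reverse_inj] at h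
    rw [← List.take_append_drop n l, h.1, h.2, List.take_append_drop]

end ClosedWords

section RegularRepresentation

variable {Γ ι : Type*} {Y : Finset Γ} {q n : ℕ}

/-- The vector `δ_g` of `ℓ²(Γ)`. -/
def delta (g : Γ) : L2 Γ := lp.single 2 g 1

theorem delta_apply (g x : Γ) : (delta g : Γ → ℂ) x = if x = g then 1 else 0 := by
  rw [delta, lp.single_apply, Pi.single_apply]

theorem inner_delta (g : Γ) (f : L2 Γ) : inner ℂ (delta g) f = (f : Γ → ℂ) g := by
  simp [delta, lp.inner_single_left]

theorem norm_delta (g : Γ) : ‖delta g‖ = 1 := by simp [delta, lp.norm_single]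

theorem norm_sum_smul_delta_sq (S : Finset ι) (c : ι → ℝ) (g : ι → Γ) :
    ‖∑ i ∈ S, (c i : ℂ) • delta (g i)‖ ^ 2 =
      ∑ i ∈ S, ∑ j ∈ S, if g i = g j then c i * c j else 0 := by
  rw [← inner_self_eq_norm_sq (𝕜 := ℂ)]
  simp only [sum_inner, inner_sum, inner_smul_left, inner_smul_right, inner_delta, delta_apply,
    Complex.conj_ofReal, mul_ite, mul_one, mul_zero, Finset.mul_sum, map_sum]
  rw [Finset.sum_comm]
  refine Finset.sum_congr rfl fun i _ => Finset.sum_congr rfl fun j _ => ?_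
  split_ifs
  · simp [mul_comm]
  · simp

theorem norm_sum_smul_delta_sq_of_injOn (S : Finset ι) (c : ι → ℝ) {g : ι → Γ}
    (hg : Set.InjOn g S) : ‖∑ i ∈ S, (c i : ℂ) • delta (g i)‖ ^ 2 = ∑ i ∈ S, c i ^ 2 := by
  rw [norm_sum_smul_delta_sq]
  refine Finset.sum_congr rfl fun i hi => ?_
  rw [Finset.sum_eq_single_of_mem i hi fun j hj hji => if_neg fun h => hji (hg hj hi h.symm),
    if_pos rfl, sq]

variable [Group Γ]

theorem deltaOne_eq_delta : deltaOne Γ = delta 1 := rfl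

theorem deltaOne_ne_zero : deltaOne Γ ≠ 0 := by
  rw [deltaOne_eq_delta, ← norm_ne_zero_iff, norm_delta]
  exact one_ne_zero

instance : Nontrivial (L2 Γ) := ⟨deltaOne Γ, 0, deltaOne_ne_zero⟩

theorem leftRegularRep_apply (g : Γ) (f : L2 Γ) (x : Γ) :
    (leftRegularRep Γ g f : Γ → ℂ) x = (f : Γ → ℂ) (g⁻¹ * x) := rfl

theorem leftRegularRep_delta (g x : Γ) : leftRegularRep Γ g (delta x) = delta (g * x) := by
  ext y
  simp only [leftRegularRep_apply, delta_apply, inv_mul_eq_iff_eq_mul]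

theorem inner_leftRegularRep (g : Γ) (f f' : L2 Γ) :
    inner ℂ (leftRegularRep Γ g f) (leftRegularRep Γ g f') = inner ℂ f f' :=
  (translate g).inner_map_map f f'

theorem norm_leftRegularRep_le (g : Γ) : ‖leftRegularRep Γ g‖ ≤ 1 :=
  (translate g).norm_toContinuousLinearMap_le

theorem adjoint_leftRegularRep (g : Γ) :
    ContinuousLinearMap.adjoint (leftRegularRep Γ g) = leftRegularRep Γ g⁻¹ := by
  refine ((ContinuousLinearMap.eq_adjoint_iff _ _).2 fun f f' => ?_).symm
  rw [← inner_leftRegularRep g, ← mul_apply_eq_comp, ← map_mul]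
  simp

theorem regularRep_of (g : Γ) : regularRep Γ (MonoidAlgebra.of ℂ Γ g) = leftRegularRep Γ g :=
  MonoidAlgebra.lift_of _ _

theorem regularRep_of_deltaOne (g : Γ) :
    regularRep Γ (MonoidAlgebra.of ℂ Γ g) (deltaOne Γ) = delta g := by
  rw [regularRep_of, deltaOne_eq_delta, leftRegularRep_delta, mul_one]

theorem regularRep_deltaOne_apply (b : MonoidAlgebra ℂ Γ) (g : Γ) :
    (regularRep Γ b (deltaOne Γ) : Γ → ℂ) g = b.coeff g := by
  induction b using MonoidAlgebra.induction_on with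
  | of x =>
    rw [regularRep_of_deltaOne, delta_apply, MonoidAlgebra.of_apply, MonoidAlgebra.coeff_single,
      Finsupp.single_apply]
    exact if_congr eq_comm rfl rfl
  | add a b ha hb =>
    rw [map_add, add_apply, lp.coeFn_add, Pi.add_apply, ha, hb, MonoidAlgebra.coeff_add,
      Finsupp.add_apply]
  | smul c a ha =>
    rw [map_smul, smul_apply, lp.coeFn_smul, Pi.smul_apply, ha, MonoidAlgebra.coeff_smul,
      Finsupp.smul_apply]

theorem trace_regularRep (b : MonoidAlgebra ℂ Γ) : trace (regularRep Γ b) = b.coeff 1 := by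
  rw [trace, deltaOne_eq_delta, inner_delta, ← deltaOne_eq_delta, regularRep_deltaOne_apply]

theorem trace_regularRep_sum_of (S : Finset ι) (g : ι → Γ) :
    trace (regularRep Γ (∑ i ∈ S, MonoidAlgebra.of ℂ Γ (g i))) = {i ∈ S | g i = 1}.card := by
  rw [trace_regularRep]
  simp [MonoidAlgebra.coeff_sum, Finsupp.finsetSum_apply, Finsupp.single_apply]

theorem twoNorm_eq_norm (b : MonoidAlgebra ℂ Γ) : twoNorm b = ‖regularRep Γ b (deltaOne Γ)‖ := by
  rw [twoNorm, trace, mul_apply_eq_comp, ContinuousLinearMap.adjoint_inner_right]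
  exact (norm_eq_sqrt_re_inner (𝕜 := ℂ) _).symm

theorem opNorm_nonneg (b : MonoidAlgebra ℂ Γ) : 0 ≤ opNorm b := norm_nonneg _

theorem opNorm_add_le (b c : MonoidAlgebra ℂ Γ) : opNorm (b + c) ≤ opNorm b + opNorm c := by
  rw [opNorm, map_add]
  exact norm_add_le _ _

theorem opNorm_sub_le (b c : MonoidAlgebra ℂ Γ) : opNorm (b - c) ≤ opNorm b + opNorm c := by
  rw [opNorm, map_sub]
  exact norm_sub_le _ _

theorem opNorm_mul_le (b c : MonoidAlgebra ℂ Γ) : opNorm (b * c) ≤ opNorm b * opNorm c := by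
  rw [opNorm, map_mul]
  exact norm_mul_le _ _

theorem opNorm_smul (r : ℝ) (b : MonoidAlgebra ℂ Γ) : opNorm (r • b) = |r| * opNorm b := by
  rw [opNorm, ← algebraMap_smul ℂ r b, map_smul, norm_smul, opNorm, Complex.coe_algebraMap,
    Complex.norm_real, Real.norm_eq_abs]

theorem opNorm_one : opNorm (1 : MonoidAlgebra ℂ Γ) = 1 := by
  rw [opNorm, map_one, norm_one]

theorem opNorm_pow_le (b : MonoidAlgebra ℂ Γ) (n : ℕ) : opNorm (b ^ n) ≤ opNorm b ^ n := by
  rw [opNorm, map_pow]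
  exact norm_pow_le _ n

theorem opNorm_sumElt_le (Y : Finset Γ) : opNorm (sumElt Y) ≤ Y.card := by
  calc opNorm (sumElt Y) ≤ ∑ _g ∈ Y, (1 : ℝ) := by
        rw [opNorm, sumElt, map_sum]
        exact norm_sum_le_of_le Y fun g _ => (regularRep_of g).symm ▸ norm_leftRegularRep_le g
    _ = Y.card := by rw [Finset.sum_const, nsmul_one]

theorem twoNorm_le_opNorm (b : MonoidAlgebra ℂ Γ) : twoNorm b ≤ opNorm b := by
  simpa [twoNorm_eq_norm, opNorm, deltaOne_eq_delta, norm_delta] using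
    (regularRep Γ b).le_opNorm (delta 1)

theorem regularRep_hSeq_deltaOne (Y : Finset Γ) (n : ℕ) :
    regularRep Γ (hSeq Y n) (deltaOne Γ) = ∑ l ∈ listWords Y n, delta (altListProd l) := by
  simp only [hSeq_eq_sum_listWords, map_sum, sum_apply, regularRep_of_deltaOne]

theorem twoNorm_hSeq_sq (Y : Finset Γ) (n : ℕ) :
    twoNorm (hSeq Y n) ^ 2 =
      {p ∈ listWords Y n ×ˢ listWords Y n | altListProd p.1 = altListProd p.2}.card := by
  have := norm_sum_smul_delta_sq (listWords Y n) (fun _ => 1) altListProd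
  simp only [Complex.ofReal_one, one_smul, mul_one] at this
  rw [twoNorm_eq_norm, regularRep_hSeq_deltaOne, this, ← Finset.sum_product', Finset.card_filter]
  simp

theorem eta_eq_card (Y : Finset Γ) (n : ℕ) : eta Y n = (closedWords Y n).card := by
  rw [eta, hSeq_eq_sum_listWords, trace_regularRep_sum_of, Complex.natCast_re, closedWords]

theorem zeta_eq_card (Y : Finset Γ) (hn : n ≠ 0) : zeta Y n = (cyclicClosedWords Y n).card := by
  rw [zeta, zSeq_eq_sum_listWords Y hn, trace_regularRep_sum_of, Complex.natCast_re,
    cyclicClosedWords, closedWords, Finset.filter_comm]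

theorem zeta_le_eta (Y : Finset Γ) (hn : n ≠ 0) : zeta Y n ≤ eta Y n := by
  rw [zeta_eq_card Y hn, eta_eq_card]
  exact_mod_cast Finset.card_filter_le _ _

theorem eta_succ_add_zeta (hY : Y.card = q + 1) (hn : 1 ≤ n) :
    eta Y (n + 1) + zeta Y n = zeta Y (n + 1) + q * eta Y n := by
  rw [zeta_eq_card Y (Nat.ne_of_gt hn), zeta_eq_card Y n.succ_ne_zero, eta_eq_card, eta_eq_card]
  exact_mod_cast card_closedWords_succ_add hY hn

theorem eta_le_xi (hY : Y.card = q + 1) (hn : n ≠ 0) : eta Y n ≤ xi Y n := by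
  have hcard := card_closedWords_add_card_listWords_le Y hn
  obtain ⟨m, rfl⟩ := Nat.exists_eq_succ_of_ne_zero hn
  rw [Nat.succ_eq_add_one, card_listWords_succ hY] at hcard
  rw [xi, twoNorm_hSeq_sq, eta_eq_card, hY, le_sub_iff_add_le]
  push_cast
  rw [add_sub_cancel_right]
  exact_mod_cast hcard

theorem xi_le_twoNorm_sq (hY : Y.card = q + 1) (n : ℕ) : xi Y n ≤ twoNorm (hSeq Y n) ^ 2 := by
  rw [xi, sub_le_self_iff, hY]
  push_cast
  rw [add_sub_cancel_right]
  positivity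

end RegularRepresentation

section Dickson

open Polynomial

/-- The monic polynomial of degree `n ≥ 1` whose value at `(u + v) ^ 2` is `u ^ (2 n) + v ^ (2 n)`
when `u v = q`. It is a shift of the Dickson polynomial which expresses `s ^ n + t ^ n` through
`s + t` and `s t`. -/
def dicksonSq (q : ℝ) (n : ℕ) : ℝ[X] := (dickson 1 (q ^ 2) n).comp (X - C (2 * q))

variable {A : Type*} [Ring A] [Algebra ℝ A]

theorem dicksonSq_zero (q : ℝ) : dicksonSq q 0 = C 2 := by
  rw [dicksonSq, dickson_zero, map_ofNat, sub_comp, natCast_comp]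
  norm_num

theorem dicksonSq_one (q : ℝ) : dicksonSq q 1 = X - C (2 * q) := by
  rw [dicksonSq, dickson_one, X_comp]

theorem dicksonSq_add_two (q : ℝ) (n : ℕ) :
    dicksonSq q (n + 2) =
      (X - C (2 * q)) * dicksonSq q (n + 1) - C (q ^ 2) * dicksonSq q n := by
  simp only [dicksonSq, dickson_add_two, sub_comp, mul_comp, X_comp, C_comp]

theorem aeval_dicksonSq_zero (q : ℝ) (x : A) : aeval x (dicksonSq q 0) = (2 : ℝ) • 1 := by
  rw [dicksonSq_zero, aeval_C, Algebra.algebraMap_eq_smul_one]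

theorem aeval_dicksonSq_one (q : ℝ) (x : A) :
    aeval x (dicksonSq q 1) = x - (2 * q) • 1 := by
  rw [dicksonSq_one, map_sub, aeval_X, aeval_C, Algebra.algebraMap_eq_smul_one]

theorem aeval_dicksonSq_add_two (q : ℝ) (x : A) (n : ℕ) :
    aeval x (dicksonSq q (n + 2)) = x * aeval x (dicksonSq q (n + 1)) -
      (2 * q) • aeval x (dicksonSq q (n + 1)) - q ^ 2 • aeval x (dicksonSq q n) := by
  rw [dicksonSq_add_two, map_sub, map_mul, map_sub, aeval_X, aeval_C, sub_mul,
    ← Algebra.smul_def, C_mul', map_smul]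

end Dickson

section Recursions

open Polynomial

variable {Γ : Type*} {Y : Finset Γ} {q : ℕ}

/-- The number of ways to prepend a letter of `Y` to a word in `E_n`, where `|Y| = q + 1`. -/
def extensionCount (q n : ℕ) : ℝ := if n = 0 then q + 1 else q

theorem extensionCount_zero (q : ℕ) : extensionCount q 0 = q + 1 := if_pos rfl

theorem extensionCount_of_ne_zero {n : ℕ} (hn : n ≠ 0) : extensionCount q n = q := if_neg hn

theorem card_filter_head?_ne_eq_extensionCount (hY : Y.card = q + 1) {n : ℕ} {l : List Γ}
    (hl : l ∈ listWords Y n) : ({a ∈ Y | l.head? ≠ some a}.card : ℝ) = extensionCount q n := by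
  cases n with
  | zero =>
    obtain rfl := List.length_eq_zero_iff.1 (length_of_mem_listWords hl)
    simp [extensionCount_zero, hY]
  | succ n => rw [extensionCount_of_ne_zero n.succ_ne_zero, card_filter_head?_ne hY hl]

variable [Group Γ]

theorem sum_of_mul_hSeq_succ (hY : Y.card = q + 1) (n : ℕ) (ε : Γ → Γ)
    (hε : ∀ a, ε a = if Even n then a⁻¹ else a) :
    (∑ a ∈ Y, MonoidAlgebra.of ℂ Γ (ε a)) * hSeq Y (n + 1) =
      hSeq Y (n + 2) + extensionCount q n • hSeq Y n := by
  have prepend : ∀ l ∈ listWords Y (n + 1), ∀ a,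
      MonoidAlgebra.of ℂ Γ (ε a) * MonoidAlgebra.of ℂ Γ (altListProd l) =
        MonoidAlgebra.of ℂ Γ (altListProd (a :: l)) := by
    intro l hl a
    rw [← map_mul, altListProd, hε, length_of_mem_listWords hl]
    simp only [Nat.even_add_one, ite_not]
  have cancel (a : Γ) (l : List Γ) : altListProd (a :: a :: l) = altListProd l := by
    by_cases h : Even l.length <;> simp [altListProd, h, Nat.even_add_one]
  rw [hSeq_eq_sum_listWords Y (n + 1), Finset.sum_mul_sum,
    Finset.sum_congr rfl fun a _ => Finset.sum_congr rfl fun l hl => prepend l hl a,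
    sum_sum_cons_listWords Y n fun l => MonoidAlgebra.of ℂ Γ (altListProd l),
    hSeq_eq_sum_listWords, hSeq_eq_sum_listWords, Finset.smul_sum]
  congr 1
  refine Finset.sum_congr rfl fun l hl => ?_
  simp only [cancel, Finset.sum_const]
  rw [← Nat.cast_smul_eq_nsmul ℝ, card_filter_head?_ne_eq_extensionCount hY hl]

theorem sumElt_inv_mul_hSeq (hY : Y.card = q + 1) {n : ℕ} (hn : Even n) :
    sumElt Y⁻¹ * hSeq Y (n + 1) = hSeq Y (n + 2) + extensionCount q n • hSeq Y n := by
  rw [← sum_of_mul_hSeq_succ hY n (·⁻¹) (by simp [hn]), sumElt, ← Finset.image_inv_eq_inv,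
    Finset.sum_image inv_injective.injOn]

theorem sumElt_mul_hSeq (hY : Y.card = q + 1) {n : ℕ} (hn : Odd n) :
    sumElt Y * hSeq Y (n + 1) = hSeq Y (n + 2) + (q : ℝ) • hSeq Y n := by
  rw [← extensionCount_of_ne_zero hn.pos.ne', ← sum_of_mul_hSeq_succ hY n id (by simp [hn])]
  rfl

/-- The element `h* h` of the group ring. -/
def starMulSelf (Y : Finset Γ) : MonoidAlgebra ℂ Γ := sumElt Y⁻¹ * sumElt Y

theorem hSeq_zero (Y : Finset Γ) : hSeq Y 0 = 1 := by
  rw [hSeq_eq_sum_listWords, listWords_zero, Finset.sum_singleton, altListProd, map_one]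

theorem hSeq_one (Y : Finset Γ) : hSeq Y 1 = sumElt Y := by
  rw [hSeq_eq_sum_listWords, sum_listWords_succ, sumElt]
  simp [listWords_zero, altListProd, Finset.filter_singleton]

theorem hSeq_two (hY : Y.card = q + 1) :
    hSeq Y 2 = starMulSelf Y - ((q : ℝ) + 1) • 1 := by
  rw [starMulSelf, ← hSeq_one Y, sumElt_inv_mul_hSeq hY Even.zero, hSeq_zero, extensionCount_zero,
    add_sub_cancel_right]

theorem hSeq_add_four (hY : Y.card = q + 1) (n : ℕ) :
    hSeq Y (2 * n + 4) = starMulSelf Y * hSeq Y (2 * n + 2) - (2 * q : ℝ) • hSeq Y (2 * n + 2) -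
      ((q : ℝ) * extensionCount q (2 * n)) • hSeq Y (2 * n) := by
  have htwo := sumElt_inv_mul_hSeq hY (even_two_mul n)
  have hthree := sumElt_mul_hSeq hY (odd_two_mul_add_one n)
  have hfour := sumElt_inv_mul_hSeq hY (n := 2 * n + 2) (by simp [Nat.even_add])
  rw [extensionCount_of_ne_zero (by lia), ← sub_eq_iff_eq_add] at hfour
  rw [← hfour, ← sub_eq_iff_eq_add.2 hthree, mul_sub, mul_smul_comm, htwo, starMulSelf, mul_assoc]
  module

theorem hSeq_sub_eq_aeval_dicksonSq (hY : Y.card = q + 1) (n : ℕ) :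
    hSeq Y (2 * n + 2) - extensionCount q (2 * n) • hSeq Y (2 * n) =
      aeval (starMulSelf Y) (dicksonSq q (n + 1)) - aeval (starMulSelf Y) (dicksonSq q n) := by
  induction n using Nat.twoStepInduction with
  | zero =>
    simp only [mul_zero, zero_add, hSeq_two hY, hSeq_zero, aeval_dicksonSq_zero,
      aeval_dicksonSq_one, extensionCount_zero]
    module
  | one =>
    simp only [mul_one, zero_add, Nat.reduceAdd, aeval_dicksonSq_add_two, aeval_dicksonSq_zero,
      aeval_dicksonSq_one, extensionCount_of_ne_zero two_ne_zero, hSeq_two hY]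
    rw [show hSeq Y 4 = _ from hSeq_add_four hY 0]
    simp only [mul_zero, zero_add, hSeq_zero, hSeq_two hY, extensionCount_zero, mul_sub,
      mul_smul_comm, mul_one]
    module
  | more n ih₀ ih₁ =>
    have next : hSeq Y (2 * n + 6) = starMulSelf Y * hSeq Y (2 * n + 4) -
        (2 * q : ℝ) • hSeq Y (2 * n + 4) - ((q : ℝ) * q) • hSeq Y (2 * n + 2) := by
      rw [show hSeq Y (2 * n + 6) = _ from hSeq_add_four hY (n + 1),
        extensionCount_of_ne_zero (by lia), mul_add_one]
    rw [mul_add_one, extensionCount_of_ne_zero (by lia), sub_eq_iff_eq_add] at ih₁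
    rw [sub_eq_iff_eq_add] at ih₀
    rw [extensionCount_of_ne_zero (by lia), show hSeq Y (2 * (n + 2) + 2) = _ from next,
      show hSeq Y (2 * (n + 2)) = _ from hSeq_add_four hY n,
      show hSeq Y (2 * n + 4) = _ from ih₁, aeval_dicksonSq_add_two q _ (n + 1), mul_add,
      mul_smul_comm, mul_sub, ih₀, aeval_dicksonSq_add_two q _ n]
    module

theorem adjoint_regularRep_sumElt (Y : Finset Γ) :
    ContinuousLinearMap.adjoint (regularRep Γ (sumElt Y)) = regularRep Γ (sumElt Y⁻¹) := by
  rw [sumElt, sumElt, ← Finset.image_inv_eq_inv, Finset.sum_image inv_injective.injOn, map_sum,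
    map_sum, map_sum]
  refine Finset.sum_congr rfl fun g _ => ?_
  rw [regularRep_of, regularRep_of, adjoint_leftRegularRep]

theorem regularRep_starMulSelf (Y : Finset Γ) :
    regularRep Γ (starMulSelf Y) = star (regularRep Γ (sumElt Y)) * regularRep Γ (sumElt Y) := by
  rw [starMulSelf, map_mul, ← adjoint_regularRep_sumElt, ContinuousLinearMap.star_eq_adjoint]

theorem regularRep_starMulSelf_nonneg (Y : Finset Γ) : 0 ≤ regularRep Γ (starMulSelf Y) :=
  regularRep_starMulSelf Y ▸ star_mul_self_nonneg _

theorem norm_regularRep_starMulSelf (Y : Finset Γ) :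
    ‖regularRep Γ (starMulSelf Y)‖ = opNorm (sumElt Y) ^ 2 := by
  rw [regularRep_starMulSelf, ContinuousLinearMap.star_eq_adjoint, opNorm, sq]
  exact ContinuousLinearMap.norm_adjoint_comp_self _

end Recursions

section LargerRoot

variable {q x y u v : ℝ}

/-- The larger solution `u` of `u + q / u = √x`, for `4 q ≤ x`; the smaller one is
`√x - largerRoot q x`. -/
def largerRoot (q x : ℝ) : ℝ := (√x + √(x - 4 * q)) / 2

theorem largerRoot_nonneg (q x : ℝ) : 0 ≤ largerRoot q x := by unfold largerRoot; positivity

theorem largerRoot_mono (q : ℝ) : Monotone (largerRoot q) := fun x y h => by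
  unfold largerRoot
  gcongr

theorem continuous_largerRoot (q : ℝ) : Continuous (largerRoot q) := by
  unfold largerRoot
  fun_prop

theorem largerRoot_four_mul (q : ℝ) : largerRoot q (4 * q) = √q := by
  rw [largerRoot, sub_self, Real.sqrt_zero, Real.sqrt_mul zero_le_four,
    show (4 : ℝ) = 2 ^ 2 by norm_num, Real.sqrt_sq zero_le_two]
  ring

theorem sqrt_le_largerRoot (hx : 4 * q ≤ x) : √q ≤ largerRoot q x :=
  largerRoot_four_mul q ▸ largerRoot_mono q hx

theorem sqrt_lt_largerRoot (hq : 0 ≤ q) (hx : 4 * q < x) : √q < largerRoot q x := by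
  rw [← largerRoot_four_mul, largerRoot, largerRoot]
  have hsqrt : √(4 * q) < √x := Real.sqrt_lt_sqrt (by positivity) hx
  have hsqrt' : √(4 * q - 4 * q) ≤ √(x - 4 * q) := Real.sqrt_le_sqrt (by gcongr)
  linarith

theorem le_largerRoot_sq (hx : 4 * q ≤ x) : q ≤ largerRoot q x ^ 2 :=
  (Real.sqrt_le_left (largerRoot_nonneg q x)).1 (sqrt_le_largerRoot hx)

theorem sqrt_sub_largerRoot_nonneg (hq : 0 ≤ q) : 0 ≤ √x - largerRoot q x := by
  have : √(x - 4 * q) ≤ √x := Real.sqrt_le_sqrt (by linarith)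
  rw [largerRoot]
  linarith

theorem sqrt_le_two_mul_largerRoot (q x : ℝ) : √x ≤ 2 * largerRoot q x := by
  rw [largerRoot]
  linarith [Real.sqrt_nonneg (x - 4 * q)]

theorem largerRoot_mul_sqrt_sub (hq : 0 ≤ q) (hx : 4 * q ≤ x) :
    largerRoot q x * (√x - largerRoot q x) = q := by
  have hsq := Real.sq_sqrt (show 0 ≤ x by linarith)
  have hsq' := Real.sq_sqrt (sub_nonneg.2 hx)
  rw [largerRoot]
  linear_combination hsq / 4 - hsq' / 4

theorem exists_lt_largerRoot (hx : 4 * q < x) (hu : u < largerRoot q x) :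
    ∃ r, 4 * q < r ∧ r < x ∧ u < largerRoot q r := by
  have hnear : ∀ᶠ r in 𝓝[<] x, u < largerRoot q r :=
    ((continuous_largerRoot q).continuousAt.eventually_const_lt hu).filter_mono nhdsWithin_le_nhds
  obtain ⟨r, hur, hr, hrx⟩ := (hnear.and (Ioo_mem_nhdsLT hx)).exists
  exact ⟨r, hr, hrx, hur⟩

theorem eval_dicksonSq_add_sq (h : u * v = q) (n : ℕ) :
    (dicksonSq q n).eval ((u + v) ^ 2) = u ^ (2 * n) + v ^ (2 * n) := by
  induction n using Nat.twoStepInduction with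
  | zero => norm_num [dicksonSq_zero]
  | one => rw [dicksonSq_one, ← h]; simp; ring
  | more n ih₀ ih₁ =>
    simp only [dicksonSq_add_two, Polynomial.eval_sub, Polynomial.eval_mul, Polynomial.eval_X,
      Polynomial.eval_C, ih₀, ih₁]
    rw [← h]
    ring

theorem eval_dicksonSq_eq (hq : 0 ≤ q) (hx : 4 * q ≤ x) (n : ℕ) :
    (dicksonSq q n).eval x = largerRoot q x ^ (2 * n) + (√x - largerRoot q x) ^ (2 * n) := by
  rw [← eval_dicksonSq_add_sq (largerRoot_mul_sqrt_sub hq hx), add_sub_cancel,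
    Real.sq_sqrt (by linarith)]

theorem eval_dicksonSq_cos (q φ : ℝ) (n : ℕ) :
    (dicksonSq q n).eval (2 * q + 2 * q * Real.cos φ) = 2 * q ^ n * Real.cos (n * φ) := by
  induction n using Nat.twoStepInduction with
  | zero => simp [dicksonSq_zero]
  | one => simp [dicksonSq_one]
  | more n ih₀ ih₁ =>
    have hcos : Real.cos ((n + 2 : ℕ) * φ) + Real.cos (n * φ) =
        2 * Real.cos φ * Real.cos ((n + 1 : ℕ) * φ) := by
      rw [Real.cos_add_cos]
      push_cast
      ring_nf
    simp only [dicksonSq_add_two, Polynomial.eval_sub, Polynomial.eval_mul, Polynomial.eval_X,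
      Polynomial.eval_C, ih₀, ih₁]
    linear_combination (-2 * q ^ (n + 2)) * hcos

theorem abs_eval_dicksonSq_le (hx₀ : 0 ≤ x) (hx : x ≤ 4 * q) (n : ℕ) :
    |(dicksonSq q n).eval x| ≤ 2 * q ^ n := by
  have hq : 0 ≤ q := by linarith
  obtain ⟨φ, rfl⟩ : ∃ φ, x = 2 * q + 2 * q * Real.cos φ := by
    refine ⟨Real.arccos ((x - 2 * q) / (2 * q)), ?_⟩
    rcases hq.eq_or_lt with rfl | hq
    · linarith
    · rw [Real.cos_arccos, mul_div_cancel₀ _ (by positivity), add_sub_cancel]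
      · rw [le_div_iff₀ (by positivity)]; linarith
      · rw [div_le_iff₀ (by positivity)]; linarith
  rw [eval_dicksonSq_cos, abs_mul, abs_of_nonneg (by positivity)]
  exact mul_le_of_le_one_right (by positivity) (Real.abs_cos_le_one _)

theorem abs_eval_dicksonSq_le_largerRoot (hq : 0 ≤ q) (hy : 4 * q ≤ y) (hx₀ : 0 ≤ x) (hxy : x ≤ y)
    (n : ℕ) : |(dicksonSq q n).eval x| ≤ 2 * largerRoot q y ^ (2 * n) := by
  rcases le_total x (4 * q) with hx | hx
  · refine (abs_eval_dicksonSq_le hx₀ hx n).trans ?_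
    rw [pow_mul]
    gcongr
    exact le_largerRoot_sq hy
  · have hsmaller := sqrt_sub_largerRoot_nonneg (x := x) hq
    have hle : √x - largerRoot q x ≤ largerRoot q x := by
      linarith [sqrt_le_two_mul_largerRoot q x]
    have hmono := largerRoot_mono q hxy
    have hroot := largerRoot_nonneg q x
    rw [eval_dicksonSq_eq hq hx, abs_of_nonneg (by positivity), two_mul (_ ^ _)]
    gcongr
    exact hle.trans hmono

theorem largerRoot_pow_le_eval_dicksonSq (hq : 0 ≤ q) (hx : 4 * q ≤ x) (hxy : x ≤ y) (n : ℕ) :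
    largerRoot q x ^ (2 * n) ≤ (dicksonSq q n).eval y := by
  rw [eval_dicksonSq_eq hq (hx.trans hxy)]
  have hsmaller := sqrt_sub_largerRoot_nonneg (x := y) hq
  refine le_add_of_le_of_nonneg ?_ (by positivity)
  gcongr
  exacts [largerRoot_nonneg q x, largerRoot_mono q hxy]

theorem neg_two_mul_pow_le_eval_dicksonSq (hq : 0 ≤ q) (hx : 0 ≤ x) (n : ℕ) :
    -(2 * q ^ n) ≤ (dicksonSq q n).eval x := by
  rcases le_total x (4 * q) with hxq | hxq
  · exact (abs_le.1 (abs_eval_dicksonSq_le hx hxq n)).1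
  · have hpow := pow_nonneg (largerRoot_nonneg q x) (2 * n)
    have heval := largerRoot_pow_le_eval_dicksonSq hq hxq le_rfl n
    linarith [pow_nonneg hq n]

end LargerRoot

section SeparatingVector

variable {H : Type*} [NormedAddCommGroup H] [InnerProductSpace ℂ H] [CompleteSpace H]
  {a : H →L[ℂ] H} {δ : H}

/-- The vector `δ` is separating for the set `S` of operators: only `0` annihilates it. -/
def IsSeparating (S : Set (H →L[ℂ] H)) (δ : H) : Prop := ∀ T ∈ S, T δ = 0 → T = 0

theorem mem_Icc_of_mem_spectrum (ha : 0 ≤ a) {x : ℝ} (hx : x ∈ spectrum ℝ a) :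
    x ∈ Set.Icc 0 ‖a‖ := by
  have hx₀ : 0 ≤ x := spectrum_nonneg_of_nonneg ha hx
  have : Nontrivial (H →L[ℂ] H) := by
    by_contra h
    rw [not_nontrivial_iff_subsingleton] at h
    simp [spectrum.of_subsingleton] at hx
  exact ⟨hx₀, (le_abs_self x).trans (spectrum.norm_le_norm_of_mem hx)⟩

theorem cfc_mem_bicommutant (f : ℝ → ℝ) (a : H →L[ℂ] H) :
    cfc f a ∈ Set.centralizer (Set.centralizer {a}) := fun _ hS =>
  (Commute.cfc_real (hS a rfl) f).symm.eq

theorem exists_cfc_ne_zero [Nontrivial H] (ha : 0 ≤ a) {r : ℝ} (hr : r < ‖a‖) :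
    ∃ k : ℝ → ℝ, Continuous k ∧ (∀ x ≤ r, k x = 0) ∧ (∀ x ≤ ‖a‖, k x ∈ Set.Icc 0 1) ∧
      cfc k a ≠ 0 := by
  have hgap : 0 < ‖a‖ - r := sub_pos.2 hr
  refine ⟨fun x => max 0 ((x - r) / (‖a‖ - r)), by fun_prop,
    fun x hx => max_eq_left (div_nonpos_of_nonpos_of_nonneg (sub_nonpos.2 hx) hgap.le),
    fun x hx => ⟨le_max_left _ _, max_le zero_le_one ((div_le_one hgap).2 (by gcongr))⟩,
    fun hzero => ?_⟩
  have hmem : (1 : ℝ) ∈ (fun x => max 0 ((x - r) / (‖a‖ - r))) '' spectrum ℝ a :=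
    ⟨‖a‖, CStarAlgebra.norm_mem_spectrum_of_nonneg ha, by simp [hgap.ne']⟩
  rw [← cfc_map_spectrum (R := ℝ) _ a (IsSelfAdjoint.of_nonneg ha) (by fun_prop), hzero,
    spectrum.zero_eq] at hmem
  exact one_ne_zero hmem

/-- The constant is `‖k(a) δ‖²` for a bump function `k` supported near the top `‖a‖` of the
spectrum, since `f(a) ≥ β k(a)² - α`. -/
theorem IsSeparating.exists_le_inner_cfc [Nontrivial H]
    (hδ : IsSeparating (Set.centralizer (Set.centralizer {a})) δ) (ha : 0 ≤ a) {r : ℝ}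
    (hr : r < ‖a‖) :
    ∃ c : ℝ, 0 < c ∧ ∀ (f : ℝ → ℝ) (α β : ℝ), Continuous f → 0 ≤ α → 0 ≤ β →
      (∀ x, 0 ≤ x → -α ≤ f x) → (∀ x, r ≤ x → β ≤ f x) →
      c * β - α * ‖δ‖ ^ 2 ≤ (inner ℂ δ (cfc f a δ)).re := by
  obtain ⟨k, hk, hkr, hk01, hne⟩ := exists_cfc_ne_zero ha hr
  have hkδ : cfc k a δ ≠ 0 := fun h => hne (hδ _ (cfc_mem_bicommutant k a) h)
  refine ⟨‖cfc k a δ‖ ^ 2, by positivity, fun f α β hf hα hβ hlow hhigh => ?_⟩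
  have hsa : IsSelfAdjoint a := .of_nonneg ha
  have hle : β • cfc k a ^ 2 - α • (1 : H →L[ℂ] H) ≤ cfc f a := by
    rw [← cfc_pow k 2 a hk.continuousOn, ← cfc_const_mul β (fun x => k x ^ 2) a (by fun_prop),
      ← Algebra.algebraMap_eq_smul_one, ← cfc_const α a,
      ← cfc_sub _ _ a (by fun_prop) (by fun_prop)]
    refine cfc_mono (fun x hx => ?_) (by fun_prop) (by fun_prop)
    obtain ⟨hx₀, hxa⟩ := mem_Icc_of_mem_spectrum ha hx
    rcases le_total x r with hxr | hxr
    · rw [hkr x hxr]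
      linarith [hlow x hx₀]
    · have hkx : k x ^ 2 ≤ 1 := pow_le_one₀ (hk01 x hxa).1 (hk01 x hxa).2
      nlinarith [hhigh x hxr]
  have hinner : (inner ℂ δ ((cfc k a ^ 2) δ)).re = ‖cfc k a δ‖ ^ 2 := by
    rw [sq (cfc k a), mul_apply_eq_comp, ← ContinuousLinearMap.adjoint_inner_left,
      (cfc_predicate k a).adjoint_eq]
    exact inner_self_eq_norm_sq (𝕜 := ℂ) _
  have hpos := ((ContinuousLinearMap.le_def _ _).1 hle).re_inner_nonneg_right δ
  have hreal (t : ℝ) (T : H →L[ℂ] H) : (inner ℂ δ ((t • T) δ)).re = t * (inner ℂ δ (T δ)).re := by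
    rw [smul_apply, inner_smul_right_eq_smul, Complex.smul_re, smul_eq_mul]
  have hself : (inner ℂ δ ((1 : H →L[ℂ] H) δ)).re = ‖δ‖ ^ 2 := inner_self_eq_norm_sq (𝕜 := ℂ) δ
  rw [sub_apply, sub_apply, inner_sub_right, inner_sub_right] at hpos
  simp only [RCLike.re_to_complex, Complex.sub_re, hreal, hinner, hself] at hpos
  linarith

end SeparatingVector

section DicksonSpectral

open Polynomial

variable {H : Type*} [NormedAddCommGroup H] [InnerProductSpace ℂ H] [CompleteSpace H]
  {a : H →L[ℂ] H} {δ : H} {q r : ℝ}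

theorem norm_aeval_dicksonSq_le (ha : 0 ≤ a) (hq : 0 ≤ q) (hnorm : 4 * q ≤ ‖a‖) (n : ℕ) :
    ‖aeval a (dicksonSq q n)‖ ≤ 2 * largerRoot q ‖a‖ ^ (2 * n) := by
  rw [← cfc_polynomial _ a (.of_nonneg ha)]
  refine norm_cfc_le (mul_nonneg zero_le_two (pow_nonneg (largerRoot_nonneg _ _) _)) fun x hx => ?_
  obtain ⟨hx₀, hxa⟩ := mem_Icc_of_mem_spectrum ha hx
  exact abs_eval_dicksonSq_le_largerRoot hq hnorm hx₀ hxa n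

theorem IsSeparating.exists_le_inner_aeval_dicksonSq [Nontrivial H]
    (hδ : IsSeparating (Set.centralizer (Set.centralizer {a})) δ) (ha : 0 ≤ a) (hq : 0 ≤ q)
    (hr : 4 * q ≤ r) (hra : r < ‖a‖) :
    ∃ c : ℝ, 0 < c ∧ ∀ n, c * largerRoot q r ^ (2 * n) - 2 * q ^ n * ‖δ‖ ^ 2 ≤
      (inner ℂ δ (aeval a (dicksonSq q n) δ)).re := by
  obtain ⟨c, hc, hle⟩ := hδ.exists_le_inner_cfc ha hra
  refine ⟨c, hc, fun n => ?_⟩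
  rw [← cfc_polynomial _ a (.of_nonneg ha)]
  exact hle _ _ _ (Polynomial.continuous _) (by positivity)
    (pow_nonneg (largerRoot_nonneg _ _) _)
    (fun x hx => neg_two_mul_pow_le_eval_dicksonSq hq hx n)
    (fun x hx => largerRoot_pow_le_eval_dicksonSq hq hr hx n)

theorem IsSeparating.exists_le_inner_pow [Nontrivial H]
    (hδ : IsSeparating (Set.centralizer (Set.centralizer {a})) δ) (ha : 0 ≤ a) (hr : 0 ≤ r)
    (hra : r < ‖a‖) :
    ∃ c : ℝ, 0 < c ∧ ∀ n : ℕ, c * r ^ n ≤ (inner ℂ δ ((a ^ n) δ)).re := by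
  obtain ⟨c, hc, hle⟩ := hδ.exists_le_inner_cfc ha hra
  refine ⟨c, hc, fun n => ?_⟩
  rw [← cfc_pow_id (R := ℝ) a n (.of_nonneg ha)]
  simpa using hle (· ^ n) 0 (r ^ n) (by fun_prop) le_rfl (by positivity)
    (fun x hx => by simpa using pow_nonneg hx n) (fun x hx => by gcongr)

end DicksonSpectral

section RightTranslation

variable {Γ : Type*} [Group Γ]

theorem memℓp_rightTranslate (x : Γ) (f : L2 Γ) :
    Memℓp (fun y : Γ => (f : Γ → ℂ) (y * x)) 2 := by
  have hp : 0 < (2 : ENNReal).toReal := by norm_num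
  exact (memℓp_gen_iff hp).2
    ((Equiv.mulRight x).summable_iff.2 ((memℓp_gen_iff hp).1 (lp.memℓp f)))

/-- The isometry `(ρ(x) f)(y) = f (y x)` of `ℓ²(Γ)`, which commutes with the left regular
representation. -/
def rightTranslate (x : Γ) : L2 Γ →ₗᵢ[ℂ] L2 Γ where
  toFun f := ⟨fun y => (f : Γ → ℂ) (y * x), memℓp_rightTranslate x f⟩
  map_add' _ _ := rfl
  map_smul' _ _ := rfl
  norm_map' f := by
    have hp : 0 < (2 : ENNReal).toReal := by norm_num
    rw [lp.norm_eq_tsum_rpow hp, lp.norm_eq_tsum_rpow hp]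
    congr 1
    exact (Equiv.mulRight x).tsum_eq fun y => ‖(f : Γ → ℂ) y‖ ^ (2 : ENNReal).toReal

theorem rightTranslate_inv_deltaOne (x : Γ) : rightTranslate x⁻¹ (deltaOne Γ) = delta x := by
  ext y
  change (deltaOne Γ : Γ → ℂ) (y * x⁻¹) = _
  simp only [deltaOne_eq_delta, delta_apply, mul_inv_eq_one]

theorem commute_regularRep_rightTranslate (b : MonoidAlgebra ℂ Γ) (x : Γ) :
    Commute (regularRep Γ b) (rightTranslate x).toContinuousLinearMap := by
  induction b using MonoidAlgebra.induction_on with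
  | of g =>
    rw [regularRep_of]
    ext f y
    change (f : Γ → ℂ) (g⁻¹ * y * x) = (f : Γ → ℂ) (g⁻¹ * (y * x))
    rw [mul_assoc]
  | add b c hb hc => simpa only [map_add] using hb.add_left hc
  | smul r b hb => simpa only [map_smul] using hb.smul_left r

theorem isSeparating_deltaOne (b : MonoidAlgebra ℂ Γ) :
    IsSeparating (Set.centralizer (Set.centralizer {regularRep Γ b})) (deltaOne Γ) := by
  intro T hT hzero
  have hdelta (g : Γ) : T (delta g) = 0 := by
    have hcomm := hT (rightTranslate g⁻¹).toContinuousLinearMap fun S hS =>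
      hS ▸ commute_regularRep_rightTranslate b g⁻¹
    have happly := DFunLike.congr_fun hcomm (deltaOne Γ)
    rw [mul_apply_eq_comp, mul_apply_eq_comp, hzero, map_zero] at happly
    rw [← rightTranslate_inv_deltaOne]
    exact happly.symm
  refine lp.ext_continuousLinearMap ENNReal.ofNat_ne_top fun g => ContinuousLinearMap.ext_ring ?_
  exact hdelta g

end RightTranslation

section Zeta

open Polynomial

variable {Γ : Type*} [Group Γ] {Y : Finset Γ} {q : ℕ}

theorem regularRep_aeval (b : MonoidAlgebra ℂ Γ) (p : ℝ[X]) :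
    regularRep Γ (aeval b p) = aeval (regularRep Γ b) p :=
  (aeval_algHom_apply ((regularRep Γ).restrictScalars ℝ) b p).symm

theorem eta_eq_re_coeff (Y : Finset Γ) (n : ℕ) : eta Y n = ((hSeq Y (2 * n)).coeff 1).re := by
  rw [eta, trace_regularRep]

theorem eta_succ_sub (hY : Y.card = q + 1) (n : ℕ) :
    eta Y (n + 1) - extensionCount q (2 * n) * eta Y n =
      ((aeval (starMulSelf Y) (dicksonSq q (n + 1))).coeff 1).re -
        ((aeval (starMulSelf Y) (dicksonSq q n)).coeff 1).re := by
  have h := congrArg (fun b => (b.coeff 1).re) (hSeq_sub_eq_aeval_dicksonSq hY n)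
  simpa [eta_eq_re_coeff, mul_add_one] using h

theorem zeta_succ_eq (hY : Y.card = q + 1) (n : ℕ) :
    zeta Y (n + 1) = ((aeval (starMulSelf Y) (dicksonSq q (n + 1))).coeff 1).re + (q - 1) := by
  induction n with
  | zero =>
    have heta := eta_succ_sub hY 0
    have heta₀ : eta Y 0 = 1 := by simp [eta_eq_re_coeff, hSeq_zero]
    have heta₁ : eta Y 1 = 0 := by
      rw [eta_eq_card, closedWords_one, Finset.card_empty, Nat.cast_zero]
    have hzeta₁ : zeta Y 1 = 0 := by
      rw [zeta_eq_card Y one_ne_zero, cyclicClosedWords, closedWords_one, Finset.filter_empty,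
        Finset.card_empty, Nat.cast_zero]
    rw [mul_zero, extensionCount_zero, heta₀, heta₁, aeval_dicksonSq_zero] at heta
    rw [hzeta₁]
    norm_num [MonoidAlgebra.one_def] at heta ⊢
    linarith
  | succ n ih =>
    have heta := eta_succ_sub hY (n + 1)
    rw [extensionCount_of_ne_zero (by lia)] at heta
    linarith [eta_succ_add_zeta hY n.succ_pos]

theorem exists_le_zeta (hq : 1 ≤ q) (hY : Y.card = q + 1) {r : ℝ} (hr : 4 * q ≤ r)
    (hrh : r < opNorm (sumElt Y) ^ 2) :
    ∃ c : ℝ, 0 < c ∧ ∀ n, n ≠ 0 → c * largerRoot q r ^ (2 * n) - 2 * (q : ℝ) ^ n ≤ zeta Y n := by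
  obtain ⟨c, hc, hle⟩ := (isSeparating_deltaOne (starMulSelf Y)).exists_le_inner_aeval_dicksonSq
    (regularRep_starMulSelf_nonneg Y) q.cast_nonneg hr (by rwa [norm_regularRep_starMulSelf])
  refine ⟨c, hc, fun n hn => ?_⟩
  obtain ⟨n, rfl⟩ := Nat.exists_eq_succ_of_ne_zero hn
  have hq' : (1 : ℝ) ≤ q := mod_cast hq
  have htrace : c * largerRoot q r ^ (2 * (n + 1)) - 2 * (q : ℝ) ^ (n + 1) * ‖deltaOne Γ‖ ^ 2 ≤
      (trace (regularRep Γ (aeval (starMulSelf Y) (dicksonSq q (n + 1))))).re := by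
    rw [regularRep_aeval]
    exact hle (n + 1)
  rw [trace_regularRep, deltaOne_eq_delta, norm_delta] at htrace
  rw [Nat.succ_eq_add_one, zeta_succ_eq hY]
  linarith

end Zeta

section ApproximateEigenvectors

variable {H : Type*} [NormedAddCommGroup H] [InnerProductSpace ℂ H]

theorem le_opNorm_of_le_re_inner {f : ℕ → H} (hf : Tendsto (fun k => ‖f k‖) atTop atTop)
    (B : H →L[ℂ] H) {x C : ℝ}
    (h : ∀ᶠ k in atTop, x * ‖f k‖ ^ 2 - C * ‖f k‖ ≤ (inner ℂ (f k) (B (f k))).re) : x ≤ ‖B‖ := by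
  have hlim : Tendsto (fun k => x - C / ‖f k‖) atTop (𝓝 x) := by
    simpa using tendsto_const_nhds.sub (hf.const_div_atTop C)
  refine le_of_tendsto hlim ?_
  filter_upwards [h, hf.eventually_gt_atTop 0] with k hk hpos
  have hupper : (inner ℂ (f k) (B (f k))).re ≤ ‖B‖ * ‖f k‖ ^ 2 := calc
    _ ≤ ‖f k‖ * ‖B (f k)‖ := (Complex.re_le_norm _).trans (norm_inner_le_norm _ _)
    _ ≤ ‖f k‖ * (‖B‖ * ‖f k‖) := by gcongr; exact B.le_opNorm _
    _ = ‖B‖ * ‖f k‖ ^ 2 := by ring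
  refine le_of_mul_le_mul_right ?_ (pow_pos hpos 2)
  calc (x - C / ‖f k‖) * ‖f k‖ ^ 2 = x * ‖f k‖ ^ 2 - C * ‖f k‖ := by field_simp
    _ ≤ ‖B‖ * ‖f k‖ ^ 2 := hk.trans hupper

theorem exists_le_re_inner_pow (a : H →L[ℂ] H) (c : ℝ) (m : ℕ) :
    ∃ C : ℝ, 0 ≤ C ∧ ∀ f : H, c ^ m * ‖f‖ ^ 2 - C * ‖a f - (c : ℂ) • f‖ * ‖f‖ ≤
      (inner ℂ f ((a ^ m) f)).re := by
  set Q : H →L[ℂ] H := ∑ i ∈ Finset.range m, a ^ i * algebraMap ℂ (H →L[ℂ] H) c ^ (m - 1 - i)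
  have hfactor (f : H) : (a ^ m) f = Q (a f - (c : ℂ) • f) + ((c ^ m : ℝ) : ℂ) • f := by
    have hQ := Commute.geom_sum₂_mul (Algebra.commutes (c : ℂ) a).symm m
    rw [← map_pow] at hQ
    have hQf : Q (a f - (c : ℂ) • f) = (a ^ m) f - ((c : ℂ) ^ m) • f :=
      congrArg (fun T : H →L[ℂ] H => T f) hQ
    rw [hQf, Complex.ofReal_pow, sub_add_cancel]
  refine ⟨‖Q‖, norm_nonneg _, fun f => ?_⟩
  have herror : ‖(inner ℂ f (Q (a f - (c : ℂ) • f)))‖ ≤ ‖Q‖ * ‖a f - (c : ℂ) • f‖ * ‖f‖ :=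
    (norm_inner_le_norm _ _).trans <| by
      rw [mul_comm]
      gcongr
      exact Q.le_opNorm _
  have hmain : (inner ℂ f (((c ^ m : ℝ) : ℂ) • f)).re = c ^ m * ‖f‖ ^ 2 := by
    rw [inner_smul_right, Complex.re_ofReal_mul]
    congr 1
    exact inner_self_eq_norm_sq (𝕜 := ℂ) f
  rw [hfactor, inner_add_right, Complex.add_re, hmain]
  linarith [neg_le_of_abs_le ((Complex.abs_re_le_norm _).trans herror)]

end ApproximateEigenvectors

section TwoNorm

variable {Γ : Type*} [Group Γ]

theorem twoNorm_nonneg (b : MonoidAlgebra ℂ Γ) : 0 ≤ twoNorm b := Real.sqrt_nonneg _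

theorem twoNorm_add_le (b c : MonoidAlgebra ℂ Γ) : twoNorm (b + c) ≤ twoNorm b + twoNorm c := by
  rw [twoNorm_eq_norm, twoNorm_eq_norm, twoNorm_eq_norm, map_add]
  exact norm_add_le _ _

theorem twoNorm_sub_le (b c : MonoidAlgebra ℂ Γ) : twoNorm (b - c) ≤ twoNorm b + twoNorm c := by
  rw [twoNorm_eq_norm, twoNorm_eq_norm, twoNorm_eq_norm, map_sub]
  exact norm_sub_le _ _

theorem twoNorm_smul (r : ℝ) (b : MonoidAlgebra ℂ Γ) : twoNorm (r • b) = |r| * twoNorm b := by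
  rw [twoNorm_eq_norm, twoNorm_eq_norm, ← algebraMap_smul ℂ r b, map_smul, smul_apply, norm_smul,
    norm_algebraMap', Real.norm_eq_abs]

theorem twoNorm_one : twoNorm (1 : MonoidAlgebra ℂ Γ) = 1 := by
  rw [twoNorm_eq_norm, map_one, one_apply_eq_self, deltaOne_eq_delta, norm_delta]

end TwoNorm

section TestVectors

variable {Γ : Type*} [Group Γ] {X : Finset Γ} {q m n K : ℕ} {l : List Γ}

/-- The truncation `∑_{k ≤ K} q^{-k} h_{2k}` of the spherical function of the `(q + 1)`-regular tree
at the top of its spectrum. For a Leinert set `X` with `q + 1` elements, these elements are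
approximate eigenvectors of `h^* h` for `4 q`. -/
def testElt (X : Finset Γ) (q K : ℕ) : MonoidAlgebra ℂ Γ :=
  ∑ k ∈ Finset.range (K + 1), ((q : ℝ) ^ k)⁻¹ • hSeq X (2 * k)

theorem testElt_succ (X : Finset Γ) (q K : ℕ) :
    testElt X q (K + 1) = testElt X q K + ((q : ℝ) ^ (K + 1))⁻¹ • hSeq X (2 * K + 2) :=
  Finset.sum_range_succ _ _

theorem starMulSelf_mul_testElt_sub (hq : q ≠ 0) (hX : X.card = q + 1) (K : ℕ) :
    starMulSelf X * testElt X q (K + 1) - (4 * q : ℝ) • testElt X q (K + 1) =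
      ((2 - 2 * q : ℝ) • 1 - (q * ((q : ℝ) ^ (K + 1))⁻¹) • hSeq X (2 * (K + 1))) +
        ((q : ℝ) ^ (K + 1))⁻¹ • hSeq X (2 * (K + 2)) := by
  have hrec (n : ℕ) : starMulSelf X * hSeq X (2 * n + 2) =
      hSeq X (2 * n + 4) + ((2 * q : ℝ) • hSeq X (2 * n + 2) +
        ((q : ℝ) * extensionCount q (2 * n)) • hSeq X (2 * n)) := by
    rw [hSeq_add_four hX, sub_sub, sub_add_cancel]
  have hq' : (q : ℝ) ≠ 0 := mod_cast hq
  induction K with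
  | zero =>
    have htwo := hSeq_two hX
    rw [eq_sub_iff_add_eq] at htwo
    have hfour := hrec 0
    rw [mul_zero, extensionCount_zero, hSeq_zero] at hfour
    rw [testElt_succ, testElt, Finset.sum_range_one, mul_zero, hSeq_zero, mul_add, mul_smul_comm,
      mul_smul_comm, mul_one, hfour, ← htwo]
    norm_num
    match_scalars <;> field_simp <;> ring
  | succ K ih =>
    have hstep := hrec (K + 1)
    rw [extensionCount_of_ne_zero (by lia)] at hstep
    have hpow : ((q : ℝ) ^ (K + 1))⁻¹ = q * ((q : ℝ) ^ (K + 2))⁻¹ := by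
      rw [pow_succ (q : ℝ) (K + 1)]
      field_simp
    rw [testElt_succ, mul_add, mul_smul_comm, smul_add, add_sub_add_comm, ih, hstep, hpow]
    simp only [mul_add, mul_one]
    module

theorem IsLeinert.twoNorm_hSeq_sq (hX : IsLeinert X) (n : ℕ) :
    twoNorm (hSeq X n) ^ 2 = (listWords X n).card := by
  have hinj : Set.InjOn altListProd (listWords X n : Set (List Γ)) := fun l hl l' hl' h =>
    hX.eq_of_altListProd_eq hl hl' (.add_self n) h
  rw [twoNorm_eq_norm, regularRep_hSeq_deltaOne]
  simpa using norm_sum_smul_delta_sq_of_injOn (listWords X n) (fun _ => 1) hinj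

theorem IsLeinert.twoNorm_hSeq_le (hL : IsLeinert X) (hq : q ≠ 0) (hX : X.card = q + 1) (k : ℕ) :
    twoNorm (hSeq X (2 * k)) ≤ (q + 1) * (q : ℝ) ^ k := by
  have hq' : (1 : ℝ) ≤ q := mod_cast Nat.one_le_iff_ne_zero.2 hq
  refine le_of_sq_le_sq ?_ (by positivity)
  rw [hL.twoNorm_hSeq_sq]
  rcases k with _ | k
  · rw [mul_zero, listWords_zero, Finset.card_singleton, pow_zero, mul_one, Nat.cast_one]
    exact one_le_pow₀ (by linarith)
  · rw [mul_add_one, card_listWords_succ hX]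
    push_cast
    calc ((q : ℝ) + 1) * q ^ (2 * k + 1) ≤ (q + 1) * q * ((q + 1) * q ^ (2 * k + 1)) :=
          le_mul_of_one_le_left (by positivity) (by nlinarith)
      _ = ((q + 1) * q ^ (k + 1)) ^ 2 := by ring

theorem IsLeinert.twoNorm_starMulSelf_mul_testElt_sub_le (hL : IsLeinert X) (hq : q ≠ 0)
    (hX : X.card = q + 1) (K : ℕ) :
    twoNorm (starMulSelf X * testElt X q (K + 1) - (4 * q : ℝ) • testElt X q (K + 1)) ≤
      2 * q * (q + 2) := by
  have hq' : (1 : ℝ) ≤ q := mod_cast Nat.one_le_iff_ne_zero.2 hq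
  rw [starMulSelf_mul_testElt_sub hq hX]
  calc _ ≤ _ := (twoNorm_add_le _ _).trans (add_le_add_left (twoNorm_sub_le _ _) _)
    _ = (2 * q - 2) + q * ((q : ℝ) ^ (K + 1))⁻¹ * twoNorm (hSeq X (2 * (K + 1))) +
        ((q : ℝ) ^ (K + 1))⁻¹ * twoNorm (hSeq X (2 * (K + 2))) := by
      rw [twoNorm_smul, twoNorm_smul, twoNorm_smul, twoNorm_one,
        abs_of_nonpos (by linarith), abs_of_nonneg (by positivity), abs_of_nonneg (by positivity)]
      ring
    _ ≤ (2 * q - 2) + q * ((q : ℝ) ^ (K + 1))⁻¹ * ((q + 1) * (q : ℝ) ^ (K + 1)) +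
        ((q : ℝ) ^ (K + 1))⁻¹ * ((q + 1) * (q : ℝ) ^ (K + 2)) := by
      gcongr <;> exact hL.twoNorm_hSeq_le hq hX _
    _ = 2 * q * (q + 2) - 2 := by field_simp; ring
    _ ≤ 2 * q * (q + 2) := by linarith

theorem IsLeinert.injOn_sigma_listWords (hL : IsLeinert X) (S : Finset ℕ) :
    Set.InjOn (fun p : (_ : ℕ) × List Γ => altListProd p.2)
      (S.sigma fun k => listWords X (2 * k)) := by
  rintro ⟨k, l⟩ hp ⟨k', l'⟩ hp' h
  have hl := (Finset.mem_sigma.1 hp).2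
  have hl' := (Finset.mem_sigma.1 hp').2
  obtain rfl : l = l' := hL.eq_of_altListProd_eq hl hl' (by grind) h
  have hlen := (length_of_mem_listWords hl).symm.trans (length_of_mem_listWords hl')
  obtain rfl : k = k' := by dsimp only at hlen; lia
  rfl

theorem IsLeinert.twoNorm_testElt_sq (hL : IsLeinert X) (hq : q ≠ 0) (hX : X.card = q + 1)
    (K : ℕ) : twoNorm (testElt X q K) ^ 2 = 1 + K * ((q + 1) / q : ℝ) := by
  have hq' : (q : ℝ) ≠ 0 := mod_cast hq
  have hsum : regularRep Γ (testElt X q K) (deltaOne Γ) =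
      ∑ p ∈ (Finset.range (K + 1)).sigma fun k => listWords X (2 * k),
        ((((q : ℝ) ^ p.1)⁻¹ : ℝ) : ℂ) • delta (altListProd p.2) := by
    rw [testElt, map_sum, sum_apply, Finset.sum_sigma]
    refine Finset.sum_congr rfl fun k _ => ?_
    rw [← algebraMap_smul ℂ, map_smul, smul_apply, regularRep_hSeq_deltaOne, Finset.smul_sum]
    rfl
  have hlevel (k : ℕ) : (listWords X (2 * (k + 1))).card * (((q : ℝ) ^ (k + 1))⁻¹) ^ 2 =
      (q + 1) / q := by
    rw [mul_add_one, card_listWords_succ hX]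
    push_cast
    field_simp
    ring
  rw [twoNorm_eq_norm, hsum, norm_sum_smul_delta_sq_of_injOn _ _ (hL.injOn_sigma_listWords _),
    Finset.sum_sigma, Finset.sum_range_succ']
  simp only [Finset.sum_const, nsmul_eq_mul, hlevel, Finset.card_range]
  rw [mul_zero, listWords_zero, Finset.card_singleton]
  norm_num
  ring

theorem IsLeinert.coeff_hSeq (hL : IsLeinert X) (hl : l ∈ listWords X n) (heven : Even (m + n)) :
    (hSeq X m).coeff (altListProd l) = if m = n then 1 else 0 := by
  rw [hSeq_eq_sum_listWords, MonoidAlgebra.coeff_sum, Finsupp.finsetSum_apply]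
  simp only [MonoidAlgebra.of_apply, MonoidAlgebra.coeff_single, Finsupp.single_apply]
  have heq {l' : List Γ} (hl' : l' ∈ listWords X m) : altListProd l' = altListProd l ↔ l' = l :=
    ⟨hL.eq_of_altListProd_eq hl' hl heven, congrArg _⟩
  rw [Finset.sum_congr rfl fun l' hl' => if_congr (heq hl') rfl rfl, Finset.sum_ite_eq']
  refine if_congr ⟨fun hlm => ?_, fun h => h ▸ hl⟩ rfl rfl
  exact (length_of_mem_listWords hlm).symm.trans (length_of_mem_listWords hl)

theorem IsLeinert.coeff_testElt (hL : IsLeinert X) (hl : l ∈ listWords X (2 * n)) (q K : ℕ) :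
    (testElt X q K).coeff (altListProd l) = if n ≤ K then ((q : ℂ) ^ n)⁻¹ else 0 := by
  rw [testElt, MonoidAlgebra.coeff_sum, Finsupp.finsetSum_apply]
  have hterm (k : ℕ) : (((q : ℝ) ^ k)⁻¹ • hSeq X (2 * k)).coeff (altListProd l) =
      if k = n then ((q : ℂ) ^ n)⁻¹ else 0 := by
    rw [← algebraMap_smul ℂ, MonoidAlgebra.coeff_smul_apply, hL.coeff_hSeq hl (by grind)]
    split_ifs with _ hkn
    · subst hkn; simp
    · lia
    · lia
    · exact smul_zero _
  rw [Finset.sum_congr rfl fun k _ => hterm k, Finset.sum_ite_eq']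
  simp only [Finset.mem_range, Nat.lt_succ_iff]

/-- The vector `λ(testElt) δ_e` of `ℓ²(Γ)`. -/
def testVector (X : Finset Γ) (q K : ℕ) : L2 Γ := regularRep Γ (testElt X q K) (deltaOne Γ)

theorem norm_testVector (X : Finset Γ) (q K : ℕ) :
    ‖testVector X q K‖ = twoNorm (testElt X q K) :=
  (twoNorm_eq_norm _).symm

theorem IsLeinert.tendsto_norm_testVector (hL : IsLeinert X) (hq : q ≠ 0) (hX : X.card = q + 1) :
    Tendsto (fun K => ‖testVector X q K‖) atTop atTop := by
  have hsqrt (K : ℕ) : ‖testVector X q K‖ = √(1 + K * ((q + 1) / q : ℝ)) := by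
    rw [norm_testVector, ← hL.twoNorm_testElt_sq hq hX, Real.sqrt_sq (twoNorm_nonneg _)]
  simp only [hsqrt]
  refine Real.tendsto_sqrt_atTop.comp (tendsto_atTop_add_const_left _ _ ?_)
  exact tendsto_natCast_atTop_atTop.atTop_mul_const (by positivity)

theorem IsLeinert.norm_starMulSelf_testVector_sub_le (hL : IsLeinert X) (hq : q ≠ 0)
    (hX : X.card = q + 1) (K : ℕ) :
    ‖regularRep Γ (starMulSelf X) (testVector X q (K + 1)) -
      ((4 * q : ℝ) : ℂ) • testVector X q (K + 1)‖ ≤ 2 * q * (q + 2) := by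
  convert hL.twoNorm_starMulSelf_mul_testElt_sub_le hq hX K using 1
  rw [twoNorm_eq_norm, map_sub, map_mul, ← algebraMap_smul ℂ (4 * q : ℝ), map_smul]
  rfl

theorem IsLeinert.exists_le_re_inner_starMulSelf_pow (hL : IsLeinert X) (hq : q ≠ 0)
    (hX : X.card = q + 1) (m : ℕ) :
    ∃ C : ℝ, ∀ᶠ K in atTop, (4 * q : ℝ) ^ m * ‖testVector X q K‖ ^ 2 - C * ‖testVector X q K‖ ≤
      (inner ℂ (testVector X q K) ((regularRep Γ (starMulSelf X) ^ m) (testVector X q K))).re := by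
  obtain ⟨C, hC, hle⟩ := exists_le_re_inner_pow (regularRep Γ (starMulSelf X)) (4 * q) m
  refine ⟨C * (2 * q * (q + 2)), ?_⟩
  filter_upwards [eventually_ge_atTop 1] with K hK
  obtain ⟨K, rfl⟩ := Nat.exists_eq_add_of_le' hK
  refine le_trans ?_ (hle _)
  gcongr
  exact hL.norm_starMulSelf_testVector_sub_le hq hX K

theorem IsLeinert.four_mul_le_opNorm_sumElt_sq (hL : IsLeinert X) (hq : q ≠ 0)
    (hX : X.card = q + 1) : 4 * q ≤ opNorm (sumElt X) ^ 2 := by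
  obtain ⟨C, hC⟩ := hL.exists_le_re_inner_starMulSelf_pow hq hX 1
  rw [← norm_regularRep_starMulSelf]
  refine le_opNorm_of_le_re_inner (C := C) (hL.tendsto_norm_testVector hq hX) _ ?_
  simpa only [pow_one] using hC

end TestVectors

section Perturbation

variable {Γ : Type*} [Group Γ] {X : Finset Γ} {q k m K : ℕ} {l w : List Γ}

theorem IsLeinert.testVector_apply (hL : IsLeinert X) (hl : l ∈ listWords X (2 * k)) (q K : ℕ) :
    (testVector X q K : Γ → ℂ) (altListProd l) = if k ≤ K then ((q : ℂ) ^ k)⁻¹ else 0 := by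
  rw [testVector, regularRep_deltaOne_apply, hL.coeff_testElt hl]

theorem IsLeinert.le_norm_testVector_sub_apply (hL : IsLeinert X) (hq : 2 ≤ q) (hm : m ≠ 0)
    (hw : w ∈ listWords X (2 * m)) (hl : l ∈ listWords X (2 * k)) (hk : k ≤ K)
    (hhead : ∀ a ∈ w.head?, ∀ b ∈ l.head?, a ≠ b) :
    ((q : ℝ) ^ k)⁻¹ / 2 ≤ ‖(testVector X q K : Γ → ℂ) (altListProd l) -
      (leftRegularRep Γ (altListProd w) (testVector X q K) : Γ → ℂ) (altListProd l)‖ := by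
  have hq' : (2 : ℝ) ≤ q := mod_cast hq
  have hwlen := length_of_mem_listWords hw
  have hllen := length_of_mem_listWords hl
  have hwl : w.reverse ++ l ∈ listWords X (2 * (m + k)) := by
    rw [mul_add]
    refine (append_mem_listWords (by rwa [List.length_reverse]) hllen).2
      ⟨reverse_mem_listWords.2 hw, hl, ?_⟩
    rwa [List.getLast?_reverse]
  have hvalue : ‖(testVector X q K : Γ → ℂ) (altListProd l)‖ = ((q : ℝ) ^ k)⁻¹ := by
    rw [hL.testVector_apply hl, if_pos hk, norm_inv, norm_pow, Complex.norm_natCast]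
  have hshift : ‖(leftRegularRep Γ (altListProd w) (testVector X q K) : Γ → ℂ) (altListProd l)‖ ≤
      ((q : ℝ) ^ k)⁻¹ / 2 := by
    rw [leftRegularRep_apply, inv_altListProd_mul_altListProd (by grind), hL.testVector_apply hwl]
    split_ifs
    · rw [norm_inv, norm_pow, Complex.norm_natCast, pow_add, mul_inv, mul_comm, div_eq_mul_inv]
      gcongr
      exact hq'.trans (le_self_pow₀ (by linarith) hm)
    · rw [norm_zero]
      positivity
  refine le_trans ?_ (norm_sub_norm_le _ _)
  linarith

theorem IsLeinert.le_norm_testVector_sub_sq (hL : IsLeinert X) (hq : 2 ≤ q) (hX : X.card = q + 1)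
    (hm : m ≠ 0) (hw : w ∈ listWords X (2 * m)) (K : ℕ) :
    (K + 1 : ℝ) / 4 ≤
      ‖testVector X q K - leftRegularRep Γ (altListProd w) (testVector X q K)‖ ^ 2 := by
  obtain ⟨a, w', rfl⟩ : ∃ a w', w = a :: w' :=
    List.exists_cons_of_length_pos (by rw [length_of_mem_listWords hw]; lia)
  have ha : a ∈ X := (mem_listWords.1 hw).2.1 a List.mem_cons_self
  set F := testVector X q K - leftRegularRep Γ (altListProd (a :: w')) (testVector X q K)
  set S := (Finset.range (K + 1)).sigma fun k => {l ∈ listWords X (2 * k) | l.head? ≠ some a}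
  have hinj : Set.InjOn (fun p : (_ : ℕ) × List Γ => altListProd p.2) S :=
    (hL.injOn_sigma_listWords (Finset.range (K + 1))).mono <| Finset.coe_subset.2 <|
      Finset.sigma_mono subset_rfl fun k => Finset.filter_subset _ _
  have : (0 : ℝ) < q := by positivity
  calc (K + 1 : ℝ) / 4 = ∑ p ∈ S, (((q : ℝ) ^ p.1)⁻¹ / 2) ^ 2 := by
        have hlevel (k : ℕ) : (q : ℝ) ^ (2 * k) * (((q : ℝ) ^ k)⁻¹ / 2) ^ 2 = 1 / 4 := by
          field_simp
          ring
        simp only [S, Finset.sum_sigma, Finset.sum_const, card_listWords_filter_head?_ne hX _ ha,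
          nsmul_eq_mul, Nat.cast_pow, hlevel, Finset.card_range]
        push_cast
        ring
    _ ≤ ∑ p ∈ S, ‖(F : Γ → ℂ) (altListProd p.2)‖ ^ 2 := by
        refine Finset.sum_le_sum fun p hp => ?_
        obtain ⟨hk, hl⟩ := Finset.mem_sigma.1 hp
        obtain ⟨hl, hhead⟩ := Finset.mem_filter.1 hl
        gcongr
        refine hL.le_norm_testVector_sub_apply hq hm hw hl (Finset.mem_range_succ_iff.1 hk) ?_
        rintro x hx b hb rfl
        cases hx
        exact hhead hb
    _ = ∑ x ∈ S.image fun p => altListProd p.2, ‖(F : Γ → ℂ) x‖ ^ 2 :=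
        (Finset.sum_image hinj (f := fun x => ‖(F : Γ → ℂ) x‖ ^ 2)).symm
    _ ≤ ‖F‖ ^ 2 := by
        simpa using lp.sum_rpow_le_norm_rpow (p := 2) (by norm_num) F
          (S.image fun p => altListProd p.2)

/-- The element `2 b - g - g⁻¹ + 2`. When `g` is a word occurring in `b`, it has nonnegative
coefficients, and `λ` sends it to `2 λ(b) + (1 - λ(g))^* (1 - λ(g))`. -/
def perturbation (b : MonoidAlgebra ℂ Γ) (g : Γ) : MonoidAlgebra ℂ Γ :=
  (b - MonoidAlgebra.of ℂ Γ g) + (b - MonoidAlgebra.of ℂ Γ g⁻¹) + 2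

theorem regularRep_perturbation (b : MonoidAlgebra ℂ Γ) (g : Γ) :
    regularRep Γ (perturbation b g) = regularRep Γ b + regularRep Γ b +
      star (1 - leftRegularRep Γ g) * (1 - leftRegularRep Γ g) := by
  have hunitary : leftRegularRep Γ g⁻¹ * leftRegularRep Γ g = 1 := by
    rw [← map_mul, inv_mul_cancel, map_one]
  have htwo : (2 : L2 Γ →L[ℂ] L2 Γ) = 1 + 1 := one_add_one_eq_two.symm
  rw [star_sub, star_one, ContinuousLinearMap.star_eq_adjoint, adjoint_leftRegularRep, sub_mul,
    one_mul, mul_sub, hunitary, perturbation, map_add, map_add, map_sub, map_sub, regularRep_of,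
    regularRep_of, map_ofNat, htwo]
  noncomm_ring

theorem regularRep_perturbation_nonneg {b : MonoidAlgebra ℂ Γ} (hb : 0 ≤ regularRep Γ b) (g : Γ) :
    0 ≤ regularRep Γ (perturbation b g) := by
  rw [regularRep_perturbation]
  exact add_nonneg (add_nonneg hb hb) (star_mul_self_nonneg _)

theorem re_inner_regularRep_perturbation (b : MonoidAlgebra ℂ Γ) (g : Γ) (f : L2 Γ) :
    (inner ℂ f (regularRep Γ (perturbation b g) f)).re =
      2 * (inner ℂ f (regularRep Γ b f)).re + ‖f - leftRegularRep Γ g f‖ ^ 2 := by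
  have hsq : (inner ℂ f ((star (1 - leftRegularRep Γ g) * (1 - leftRegularRep Γ g)) f)).re =
      ‖f - leftRegularRep Γ g f‖ ^ 2 := by
    rw [mul_apply_eq_comp, ContinuousLinearMap.star_eq_adjoint,
      ContinuousLinearMap.adjoint_inner_right]
    exact inner_self_eq_norm_sq (𝕜 := ℂ) _
  rw [regularRep_perturbation, add_apply, add_apply, inner_add_right, inner_add_right,
    Complex.add_re, Complex.add_re, hsq, two_mul]

theorem IsLeinert.two_mul_lt_opNorm_perturbation (hL : IsLeinert X) (hq : 2 ≤ q)
    (hX : X.card = q + 1) (hm : m ≠ 0) (hw : w ∈ listWords X (2 * m)) :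
    2 * (4 * q : ℝ) ^ m < opNorm (perturbation (starMulSelf X ^ m) (altListProd w)) := by
  have hq₀ : q ≠ 0 := by lia
  have hq' : (2 : ℝ) ≤ q := mod_cast hq
  obtain ⟨C, hC⟩ := hL.exists_le_re_inner_starMulSelf_pow hq₀ hX m
  suffices 2 * (4 * q : ℝ) ^ m + 1 / 8 ≤
      opNorm (perturbation (starMulSelf X ^ m) (altListProd w)) by linarith
  refine le_opNorm_of_le_re_inner (C := 2 * C) (hL.tendsto_norm_testVector hq₀ hX) _ ?_
  filter_upwards [hC] with K hK
  have hnorm : ‖testVector X q K‖ ^ 2 ≤ 2 * (K + 1) := by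
    rw [norm_testVector, hL.twoNorm_testElt_sq hq₀ hX]
    have hratio : ((q : ℝ) + 1) / q ≤ 2 := by
      rw [div_le_iff₀ (by linarith)]
      linarith
    nlinarith [K.cast_nonneg (α := ℝ)]
  rw [re_inner_regularRep_perturbation, map_pow]
  linarith [hL.le_norm_testVector_sub_sq hq hX hm hw K]

end Perturbation

section NonnegCoeff

open scoped ComplexOrder

variable {Γ Λ : Type*} [Group Γ] [Group Λ] {b b' c c' : MonoidAlgebra ℂ Γ} {Y : Finset Γ} {g : Γ}

/-- The cone of elements of the group ring with nonnegative coefficients, which is closed under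
multiplication. -/
def nonnegCoeff (Γ : Type*) [Group Γ] : Subsemiring (MonoidAlgebra ℂ Γ) where
  carrier := {b | ∀ g, 0 ≤ b.coeff g}
  zero_mem' _ := le_rfl
  one_mem' g := by
    rw [MonoidAlgebra.one_def, MonoidAlgebra.coeff_single]
    exact Finsupp.single_nonneg.2 zero_le_one g
  add_mem' hb hc g := add_nonneg (hb g) (hc g)
  mul_mem' hb hc g := by
    rw [MonoidAlgebra.coeff_mul_apply_left]
    exact Finset.sum_nonneg fun x _ => mul_nonneg (hb _) (hc _)

theorem of_mem_nonnegCoeff (g : Γ) : MonoidAlgebra.of ℂ Γ g ∈ nonnegCoeff Γ := fun x => by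
  rw [MonoidAlgebra.of_apply, MonoidAlgebra.coeff_single]
  exact Finsupp.single_nonneg.2 zero_le_one x

theorem sumElt_mem_nonnegCoeff (Y : Finset Γ) : sumElt Y ∈ nonnegCoeff Γ :=
  sum_mem fun g _ => of_mem_nonnegCoeff g

theorem sumElt_sub_of_mem_nonnegCoeff (hg : g ∈ Y) :
    sumElt Y - MonoidAlgebra.of ℂ Γ g ∈ nonnegCoeff Γ := by
  rw [sumElt, ← Finset.sum_erase_add _ _ hg, add_sub_cancel_right]
  exact sumElt_mem_nonnegCoeff (Y.erase g)

theorem starMulSelf_mem_nonnegCoeff (Y : Finset Γ) : starMulSelf Y ∈ nonnegCoeff Γ :=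
  mul_mem (sumElt_mem_nonnegCoeff _) (sumElt_mem_nonnegCoeff _)

theorem mul_sub_mul_mem_nonnegCoeff (hbb' : b - b' ∈ nonnegCoeff Γ) (hb' : b' ∈ nonnegCoeff Γ)
    (hc : c ∈ nonnegCoeff Γ) (hcc' : c - c' ∈ nonnegCoeff Γ) :
    b * c - b' * c' ∈ nonnegCoeff Γ := by
  have hsplit : b * c - b' * c' = (b - b') * c + b' * (c - c') := by noncomm_ring
  rw [hsplit]
  exact add_mem (mul_mem hbb' hc) (mul_mem hb' hcc')

theorem starMulSelf_pow_sub_of_altListProd_mem_nonnegCoeff {l : List Γ} (hl : ∀ x ∈ l, x ∈ Y)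
    {m : ℕ} (hm : l.length = 2 * m) :
    starMulSelf Y ^ m - MonoidAlgebra.of ℂ Γ (altListProd l) ∈ nonnegCoeff Γ := by
  induction m generalizing l with
  | zero =>
    rw [mul_zero, List.length_eq_zero_iff] at hm
    rw [hm, altListProd, map_one, pow_zero, sub_self]
    exact zero_mem _
  | succ m ih =>
    obtain ⟨a, b, l, rfl⟩ : ∃ a b l', l = a :: b :: l' := by
      match l, hm with
      | a :: b :: l', _ => exact ⟨a, b, l', rfl⟩
    simp only [List.forall_mem_cons] at hl
    obtain ⟨ha, hb, hl⟩ := hl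
    simp only [List.length_cons] at hm
    have hrest := ih hl (by lia)
    rw [altListProd_cons_of_odd (by grind), altListProd_cons_of_even (by grind), ← mul_assoc,
      map_mul, map_mul, pow_succ']
    refine mul_sub_mul_mem_nonnegCoeff ?_ (mul_mem (of_mem_nonnegCoeff _) (of_mem_nonnegCoeff _))
      (pow_mem (starMulSelf_mem_nonnegCoeff Y) m) hrest
    exact mul_sub_mul_mem_nonnegCoeff (sumElt_sub_of_mem_nonnegCoeff (Finset.inv_mem_inv ha))
      (of_mem_nonnegCoeff _) (sumElt_mem_nonnegCoeff Y) (sumElt_sub_of_mem_nonnegCoeff hb)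

theorem coeff_one_le_coeff_one_mapDomain (π : Γ →* Λ) (hb : b ∈ nonnegCoeff Γ) :
    b.coeff 1 ≤ (MonoidAlgebra.mapDomainRingHom ℂ π b).coeff 1 := by
  have hsum : (MonoidAlgebra.mapDomainRingHom ℂ π b).coeff 1 =
      ∑ g ∈ b.coeff.support, if π g = 1 then b.coeff g else 0 := by
    change (Finsupp.mapDomain π b.coeff) 1 = _
    rw [Finsupp.mapDomain, Finsupp.sum, Finsupp.finsetSum_apply]
    simp only [Finsupp.single_apply]
  have hterm (g : Γ) : 0 ≤ if π g = 1 then b.coeff g else 0 := by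
    split_ifs
    exacts [hb g, le_rfl]
  rw [hsum]
  by_cases hzero : b.coeff 1 = 0
  · rw [hzero]
    exact Finset.sum_nonneg fun g _ => hterm g
  · simpa using Finset.single_le_sum (fun g _ => hterm g) (Finsupp.mem_support_iff.2 hzero)

theorem re_coeff_one_le_opNorm (b : MonoidAlgebra ℂ Γ) : (b.coeff 1).re ≤ opNorm b := by
  rw [← trace_regularRep, trace]
  calc _ ≤ ‖deltaOne Γ‖ * ‖regularRep Γ b (deltaOne Γ)‖ :=
        (Complex.re_le_norm _).trans (norm_inner_le_norm _ _)
    _ = twoNorm b := by rw [deltaOne_eq_delta, norm_delta, one_mul, ← deltaOne_eq_delta,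
        twoNorm_eq_norm]
    _ ≤ opNorm b := twoNorm_le_opNorm b

theorem le_of_forall_mul_pow_le_pow {c r s : ℝ} (hc : 0 < c) (hs : 0 ≤ s)
    (h : ∀ n : ℕ, c * r ^ n ≤ s ^ n) : r ≤ s := by
  by_contra! hsr
  have hr : 0 < r := hs.trans_lt hsr
  obtain ⟨n, hn⟩ := exists_pow_lt_of_lt_one hc ((div_lt_one hr).2 hsr)
  rw [div_pow, div_lt_iff₀ (pow_pos hr n)] at hn
  exact hn.not_ge (h n)

-- The moments `⟨a^n δ_e, δ_e⟩` determine the norm of `a ≥ 0`, and they can only grow when elements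
-- are identified in `Λ`.
theorem opNorm_le_opNorm_mapDomain (π : Γ →* Λ) (hb : b ∈ nonnegCoeff Γ)
    (hpos : 0 ≤ regularRep Γ b) : opNorm b ≤ opNorm (MonoidAlgebra.mapDomainRingHom ℂ π b) := by
  refine le_of_forall_lt_imp_le_of_dense fun r hr => ?_
  rcases le_total r 0 with hr₀ | hr₀
  · exact hr₀.trans (opNorm_nonneg _)
  obtain ⟨c, hc, hle⟩ := (isSeparating_deltaOne b).exists_le_inner_pow hpos hr₀ hr
  refine le_of_forall_mul_pow_le_pow hc (opNorm_nonneg _) fun n => ?_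
  calc c * r ^ n ≤ (inner ℂ (deltaOne Γ) ((regularRep Γ b ^ n) (deltaOne Γ))).re := hle n
    _ = ((b ^ n).coeff 1).re := by rw [← map_pow, ← trace, trace_regularRep]
    _ ≤ ((MonoidAlgebra.mapDomainRingHom ℂ π (b ^ n)).coeff 1).re :=
      (Complex.le_def.1 (coeff_one_le_coeff_one_mapDomain π (pow_mem hb n))).1
    _ ≤ opNorm (MonoidAlgebra.mapDomainRingHom ℂ π b) ^ n := by
      rw [map_pow]
      exact (re_coeff_one_le_opNorm _).trans (opNorm_pow_le _ n)

end NonnegCoeff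

section FreeGenerators

variable {α : Type*} {l : List α}

/-- The letters of `l` with alternating signs, ending in `+`: the expression of the alternating
product of `l` as a word in the free group. -/
def signedWord : List α → List (α × Bool)
  | [] => []
  | a :: l => (a, decide (Even l.length)) :: signedWord l

theorem map_fst_signedWord (l : List α) : (signedWord l).map Prod.fst = l := by
  induction l with
  | nil => rfl
  | cons a l ih => rw [signedWord, List.map_cons, ih]

theorem mk_signedWord (l : List α) :
    FreeGroup.mk (signedWord l) = altListProd (l.map FreeGroup.of) := by
  induction l with
  | nil => rfl
  | cons a l ih =>
    rw [List.map_cons, altListProd, ← ih, signedWord, List.length_map]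
    by_cases h : Even l.length
    · rw [if_pos h, decide_eq_true h]
      rfl
    · rw [if_neg h, decide_eq_false h]
      rfl

theorem isReduced_signedWord (hl : l.IsChain (· ≠ ·)) : FreeGroup.IsReduced (signedWord l) := by
  induction hl with
  | nil => exact .nil
  | singleton a => exact .singleton
  | cons_cons hab _ ih => exact List.isChain_cons_cons.2 ⟨fun h => absurd h hab, ih⟩

/-- The elements of `Y`, as free generators. -/
def freeGenerators (Y : Finset α) : Finset (FreeGroup α) :=
  Y.map ⟨FreeGroup.of, FreeGroup.of_injective⟩

theorem card_freeGenerators (Y : Finset α) : (freeGenerators Y).card = Y.card :=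
  Finset.card_map _

theorem map_of_mem_listWords_freeGenerators {Y : Finset α} {n : ℕ} :
    l.map FreeGroup.of ∈ listWords (freeGenerators Y) n ↔ l ∈ listWords Y n :=
  map_mem_listWords_map

theorem isLeinert_freeGenerators (Y : Finset α) : IsLeinert (freeGenerators Y) := by
  refine isLeinert_iff_listWords.2 fun n _ l hl hprod => ?_
  obtain ⟨l, rfl⟩ : l ∈ Set.range (List.map FreeGroup.of) := by
    rw [Set.range_list_map]
    intro x hx
    obtain ⟨a, -, rfl⟩ := Finset.mem_map.1 ((mem_listWords.1 hl).2.1 x hx)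
    exact ⟨a, rfl⟩
  rw [map_of_mem_listWords_freeGenerators] at hl
  rw [← mk_signedWord, FreeGroup.one_eq_mk] at hprod
  have hreduce := FreeGroup.reduce.sound hprod
  rw [(isReduced_signedWord (mem_listWords.1 hl).2.2).reduce_eq, FreeGroup.reduce_nil] at hreduce
  rw [← map_fst_signedWord l, hreduce]
  rfl

end FreeGenerators

section Norm

variable {Γ : Type*} [Group Γ] {Y : Finset Γ} {q : ℕ}

theorem mapDomain_of {Λ : Type*} [Group Λ] (π : Γ →* Λ) (g : Γ) :
    MonoidAlgebra.mapDomainRingHom ℂ π (MonoidAlgebra.of ℂ Γ g) = MonoidAlgebra.of ℂ Λ (π g) := by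
  simp

theorem mapDomain_starMulSelf_freeGenerators (Y : Finset Γ) :
    MonoidAlgebra.mapDomainRingHom ℂ (FreeGroup.lift (id : Γ → Γ))
      (starMulSelf (freeGenerators Y)) = starMulSelf Y := by
  simp only [starMulSelf, sumElt, map_mul, map_sum, mapDomain_of, ← Finset.image_inv_eq_inv,
    Finset.sum_image inv_injective.injOn, freeGenerators, Finset.sum_map, map_inv,
    Function.Embedding.coeFn_mk, FreeGroup.lift_apply_of, id]

theorem four_mul_le_opNorm_sumElt_sq (hq : q ≠ 0) (hY : Y.card = q + 1) :
    4 * q ≤ opNorm (sumElt Y) ^ 2 := by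
  set X := freeGenerators Y
  calc (4 * q : ℝ) ≤ opNorm (sumElt X) ^ 2 :=
        (isLeinert_freeGenerators Y).four_mul_le_opNorm_sumElt_sq hq
          ((card_freeGenerators Y).trans hY)
    _ = opNorm (starMulSelf X) := (norm_regularRep_starMulSelf X).symm
    _ ≤ opNorm (starMulSelf Y) := mapDomain_starMulSelf_freeGenerators Y ▸
        opNorm_le_opNorm_mapDomain _ (starMulSelf_mem_nonnegCoeff X)
          (regularRep_starMulSelf_nonneg X)
    _ = opNorm (sumElt Y) ^ 2 := norm_regularRep_starMulSelf Y

theorem mapDomain_perturbation {Λ : Type*} [Group Λ] (π : Γ →* Λ) (b : MonoidAlgebra ℂ Γ) {g : Γ}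
    (hg : π g = 1) : MonoidAlgebra.mapDomainRingHom ℂ π (perturbation b g) =
      MonoidAlgebra.mapDomainRingHom ℂ π b + MonoidAlgebra.mapDomainRingHom ℂ π b := by
  have htwo : (2 : MonoidAlgebra ℂ Λ) = 1 + 1 := one_add_one_eq_two.symm
  rw [perturbation, map_add, map_add, map_sub, map_sub, mapDomain_of, mapDomain_of, map_inv, hg,
    inv_one, map_one, map_ofNat, htwo]
  abel

theorem lift_altListProd_map_of (l : List Γ) :
    FreeGroup.lift (id : Γ → Γ) (altListProd (l.map FreeGroup.of)) = altListProd l := by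
  rw [← altListProd_map, List.map_map]
  simp [Function.comp_def]

theorem opNorm_starMulSelf_pow_add_self_le (Y : Finset Γ) (m : ℕ) :
    opNorm (starMulSelf Y ^ m + starMulSelf Y ^ m) ≤ 2 * (opNorm (sumElt Y) ^ 2) ^ m := by
  have hpow := opNorm_pow_le (starMulSelf Y) m
  rw [show opNorm (starMulSelf Y) = _ from norm_regularRep_starMulSelf Y] at hpow
  rw [two_mul]
  exact (opNorm_add_le _ _).trans (add_le_add hpow hpow)

theorem perturbation_starMulSelf_pow_mem_nonnegCoeff {m : ℕ} {w : List Γ}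
    (hw : w ∈ listWords Y (2 * m)) :
    perturbation (starMulSelf Y ^ m) (altListProd w) ∈ nonnegCoeff Γ := by
  obtain ⟨hlen, hmem, -⟩ := mem_listWords.1 hw
  have hinv : (altListProd w)⁻¹ = altListProd w.reverse := by
    simpa [altListProd] using inv_altListProd_mul_altListProd (l := w) (l' := []) (by simp [hlen])
  refine add_mem (add_mem (starMulSelf_pow_sub_of_altListProd_mem_nonnegCoeff hmem hlen) ?_)
    (ofNat_mem _ 2)
  rw [hinv]
  exact starMulSelf_pow_sub_of_altListProd_mem_nonnegCoeff (by simpa using hmem) (by simpa)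

-- A relation in `Γ` is a word `w` in the kernel of the projection from the free group, and there
-- the perturbation of `(h^* h)^m` by `w`, which has too large a norm, becomes `2 (h^* h)^m`.
theorem four_mul_lt_opNorm_sumElt_sq (hq : 2 ≤ q) (hY : Y.card = q + 1) (hL : ¬ IsLeinert Y) :
    4 * q < opNorm (sumElt Y) ^ 2 := by
  obtain ⟨m, l, hl, hone, hm⟩ : ∃ m, ∃ l ∈ listWords Y (2 * m), altListProd l = 1 ∧ m ≠ 0 := by
    rw [isLeinert_iff_listWords] at hL
    push Not at hL
    obtain ⟨n, ⟨m, rfl⟩, l, hl, hone, hnil⟩ := hL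
    rw [← two_mul] at hl
    exact ⟨m, l, hl, hone, by rintro rfl; exact hnil (by simpa [listWords_zero] using hl)⟩
  set X := freeGenerators Y
  have hX : X.card = q + 1 := (card_freeGenerators Y).trans hY
  have hw : l.map FreeGroup.of ∈ listWords X (2 * m) := map_of_mem_listWords_freeGenerators.2 hl
  have hpow : 2 * (4 * q : ℝ) ^ m < 2 * (opNorm (sumElt Y) ^ 2) ^ m := by
    calc 2 * (4 * q : ℝ) ^ m
        < opNorm (perturbation (starMulSelf X ^ m) (altListProd (l.map FreeGroup.of))) :=
          (isLeinert_freeGenerators Y).two_mul_lt_opNorm_perturbation hq hX hm hw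
      _ ≤ opNorm (MonoidAlgebra.mapDomainRingHom ℂ (FreeGroup.lift (id : Γ → Γ))
            (perturbation (starMulSelf X ^ m) (altListProd (l.map FreeGroup.of)))) := by
          refine opNorm_le_opNorm_mapDomain _ (perturbation_starMulSelf_pow_mem_nonnegCoeff hw)
            (regularRep_perturbation_nonneg ?_ _)
          rw [map_pow]
          exact CStarAlgebra.pow_nonneg (regularRep_starMulSelf_nonneg X) m
      _ = opNorm (starMulSelf Y ^ m + starMulSelf Y ^ m) := by
          rw [mapDomain_perturbation _ _ ((lift_altListProd_map_of l).trans hone), map_pow,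
            mapDomain_starMulSelf_freeGenerators]
      _ ≤ 2 * (opNorm (sumElt Y) ^ 2) ^ m := opNorm_starMulSelf_pow_add_self_le Y m
  exact lt_of_pow_lt_pow_left₀ m (sq_nonneg _) (lt_of_mul_lt_mul_left hpow zero_le_two)

end Norm

section GrowthRate

variable {Γ : Type*} [Group Γ] {Y : Finset Γ} {q : ℕ}

/-- The number `γ`, the larger solution of `γ + q / γ = ‖h‖`. -/
def growthRate (q : ℕ) (Y : Finset Γ) : ℝ := largerRoot q (opNorm (sumElt Y) ^ 2)

theorem growthRate_eq (q : ℕ) (Y : Finset Γ) : growthRate q Y =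
    1 / 2 * (opNorm (sumElt Y) + √(opNorm (sumElt Y) ^ 2 - 4 * q)) := by
  rw [growthRate, largerRoot, Real.sqrt_sq (opNorm_nonneg _)]
  ring

theorem sqrt_le_growthRate (hq : q ≠ 0) (hY : Y.card = q + 1) : √q ≤ growthRate q Y :=
  sqrt_le_largerRoot (four_mul_le_opNorm_sumElt_sq hq hY)

theorem sqrt_lt_growthRate (hq : 2 ≤ q) (hY : Y.card = q + 1) (hL : ¬ IsLeinert Y) :
    √q < growthRate q Y :=
  sqrt_lt_largerRoot q.cast_nonneg (four_mul_lt_opNorm_sumElt_sq hq hY hL)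

theorem le_growthRate_sq (hq : q ≠ 0) (hY : Y.card = q + 1) : q ≤ growthRate q Y ^ 2 :=
  le_largerRoot_sq (four_mul_le_opNorm_sumElt_sq hq hY)

theorem one_le_growthRate (hq : q ≠ 0) (hY : Y.card = q + 1) : 1 ≤ growthRate q Y :=
  (Real.one_le_sqrt.2 (mod_cast Nat.one_le_iff_ne_zero.2 hq)).trans (sqrt_le_growthRate hq hY)

theorem growthRate_le (hq : q ≠ 0) (hY : Y.card = q + 1) : growthRate q Y ≤ q := by
  have hq' : (1 : ℝ) ≤ q := mod_cast Nat.one_le_iff_ne_zero.2 hq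
  have hnorm : opNorm (sumElt Y) ≤ q + 1 := by simpa [hY] using opNorm_sumElt_le Y
  have hsqrt : √(opNorm (sumElt Y) ^ 2 - 4 * q) ≤ q - 1 := by
    rw [Real.sqrt_le_left (by linarith)]
    linear_combination pow_le_pow_left₀ (opNorm_nonneg _) hnorm 2
  rw [growthRate_eq]
  linarith

theorem growthRate_add_div (hq : q ≠ 0) (hY : Y.card = q + 1) :
    growthRate q Y + q / growthRate q Y = opNorm (sumElt Y) := by
  have hmul := largerRoot_mul_sqrt_sub q.cast_nonneg (four_mul_le_opNorm_sumElt_sq hq hY)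
  rw [← growthRate, Real.sqrt_sq (opNorm_nonneg (sumElt Y))] at hmul
  have hpos := zero_lt_one.trans_le (one_le_growthRate hq hY)
  rw [← eq_sub_iff_add_eq', div_eq_iff hpos.ne', ← hmul, mul_comm]

theorem opNorm_sumElt_le_two_mul_growthRate (q : ℕ) (Y : Finset Γ) :
    opNorm (sumElt Y) ≤ 2 * growthRate q Y := by
  have := sqrt_le_two_mul_largerRoot q (opNorm (sumElt Y) ^ 2)
  rwa [Real.sqrt_sq (opNorm_nonneg _)] at this

theorem opNorm_aeval_dicksonSq_le (hq : q ≠ 0) (hY : Y.card = q + 1) (n : ℕ) :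
    opNorm (Polynomial.aeval (starMulSelf Y) (dicksonSq q n)) ≤ 2 * growthRate q Y ^ (2 * n) := by
  rw [opNorm, regularRep_aeval, growthRate, ← norm_regularRep_starMulSelf]
  refine norm_aeval_dicksonSq_le (regularRep_starMulSelf_nonneg Y) q.cast_nonneg ?_ n
  exact norm_regularRep_starMulSelf Y ▸ four_mul_le_opNorm_sumElt_sq hq hY

theorem opNorm_hSeq_two_mul_add_two_le (hq : q ≠ 0) (hY : Y.card = q + 1) (n : ℕ) :
    opNorm (hSeq Y (2 * n + 2)) ≤
      extensionCount q (2 * n) * opNorm (hSeq Y (2 * n)) + 4 * growthRate q Y ^ (2 * n + 2) := by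
  have hcount : 0 ≤ extensionCount q (2 * n) := by unfold extensionCount; positivity
  have hpow : growthRate q Y ^ (2 * n) ≤ growthRate q Y ^ (2 * n + 2) :=
    pow_le_pow_right₀ (one_le_growthRate hq hY) (by lia)
  have hdickson := opNorm_sub_le (Polynomial.aeval (starMulSelf Y) (dicksonSq q (n + 1)))
    (Polynomial.aeval (starMulSelf Y) (dicksonSq q n))
  have htriangle := opNorm_add_le (extensionCount q (2 * n) • hSeq Y (2 * n))
    (hSeq Y (2 * n + 2) - extensionCount q (2 * n) • hSeq Y (2 * n))
  rw [add_sub_cancel, opNorm_smul, abs_of_nonneg hcount, hSeq_sub_eq_aeval_dicksonSq hY]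
    at htriangle
  have hle := opNorm_aeval_dicksonSq_le hq hY n
  have hle' := opNorm_aeval_dicksonSq_le hq hY (n + 1)
  rw [mul_add_one] at hle'
  linarith

theorem opNorm_hSeq_two_mul_le (hq : q ≠ 0) (hY : Y.card = q + 1) (n : ℕ) :
    opNorm (hSeq Y (2 * n)) ≤ (4 * n + 2) * growthRate q Y ^ (2 * n) := by
  have hγ := one_le_growthRate hq hY
  have hqγ := le_growthRate_sq hq hY
  induction n with
  | zero => norm_num [hSeq_zero, opNorm_one]
  | succ n ih =>
    have hcount : extensionCount q (2 * n) * opNorm (hSeq Y (2 * n)) ≤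
        (4 * n + 2) * growthRate q Y ^ (2 * n + 2) := by
      rcases eq_or_ne n 0 with rfl | hn
      · rw [mul_zero, extensionCount_zero, hSeq_zero, opNorm_one]
        push_cast
        nlinarith
      · rw [extensionCount_of_ne_zero (by lia), pow_add]
        calc q * opNorm (hSeq Y (2 * n))
            ≤ growthRate q Y ^ 2 * ((4 * n + 2) * growthRate q Y ^ (2 * n)) := by
              gcongr
              exact opNorm_nonneg _
          _ = _ := by ring
    rw [mul_add_one]
    push_cast
    linarith [opNorm_hSeq_two_mul_add_two_le hq hY n]

theorem opNorm_hSeq_two_mul_add_one_le (hq : q ≠ 0) (hY : Y.card = q + 1) (n : ℕ) :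
    opNorm (hSeq Y (2 * n + 1)) ≤ 4 * (n + 1) ^ 2 * growthRate q Y ^ (2 * n + 1) := by
  have hγ : 0 < growthRate q Y := zero_lt_one.trans_le (one_le_growthRate hq hY)
  have hh := opNorm_sumElt_le_two_mul_growthRate q Y
  induction n with
  | zero =>
    rw [mul_zero, zero_add, hSeq_one]
    norm_num
    linarith
  | succ n ih =>
    have hrec : opNorm (hSeq Y (2 * n + 3)) ≤
        opNorm (sumElt Y) * opNorm (hSeq Y (2 * (n + 1))) + q * opNorm (hSeq Y (2 * n + 1)) := by
      rw [eq_sub_of_add_eq (sumElt_mul_hSeq hY (odd_two_mul_add_one n)).symm]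
      refine (opNorm_sub_le _ _).trans (add_le_add (opNorm_mul_le _ _) ?_)
      rw [opNorm_smul, Nat.abs_cast]
    calc opNorm (hSeq Y (2 * n + 3))
        ≤ 2 * growthRate q Y * ((4 * (n + 1 : ℕ) + 2) * growthRate q Y ^ (2 * (n + 1))) +
          growthRate q Y ^ 2 * (4 * (n + 1) ^ 2 * growthRate q Y ^ (2 * n + 1)) := by
          refine hrec.trans (add_le_add ?_ ?_)
          · exact mul_le_mul hh (opNorm_hSeq_two_mul_le hq hY _) (opNorm_nonneg _) (by positivity)
          · exact mul_le_mul (le_growthRate_sq hq hY) ih (opNorm_nonneg _) (by positivity)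
      _ = _ := by push_cast; ring

theorem opNorm_hSeq_le (hq : q ≠ 0) (hY : Y.card = q + 1) (n : ℕ) :
    opNorm (hSeq Y n) ≤ 2 * (n + 1) ^ 2 * growthRate q Y ^ n := by
  have hγ : 0 < growthRate q Y := zero_lt_one.trans_le (one_le_growthRate hq hY)
  rcases n.even_or_odd' with ⟨k, rfl | rfl⟩
  · refine (opNorm_hSeq_two_mul_le hq hY k).trans ?_
    refine mul_le_mul_of_nonneg_right ?_ (by positivity)
    push_cast
    nlinarith [k.cast_nonneg (α := ℝ)]
  · refine (opNorm_hSeq_two_mul_add_one_le hq hY k).trans ?_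
    refine mul_le_mul_of_nonneg_right ?_ (by positivity)
    push_cast
    nlinarith [k.cast_nonneg (α := ℝ)]

end GrowthRate

section Limits

theorem tendsto_rpow_one_div_two_mul {s : ℕ → ℝ} {γ : ℝ} (hγ : 0 < γ)
    (hupper : ∀ v, γ < v → ∀ᶠ n in atTop, s n ≤ v ^ (2 * n))
    (hlower : ∀ u, 0 < u → u < γ → ∀ᶠ n in atTop, u ^ (2 * n) ≤ s n) :
    Tendsto (fun n : ℕ => s n ^ (1 / (2 * (n : ℝ)))) atTop (𝓝 γ) := by
  have hroot {u : ℝ} {n : ℕ} (hu : 0 ≤ u) (hn : n ≠ 0) :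
      (u ^ (2 * n)) ^ (1 / (2 * (n : ℝ))) = u := by
    have hcast : 1 / (2 * (n : ℝ)) = ((2 * n : ℕ) : ℝ)⁻¹ := by push_cast; rw [one_div]
    rw [hcast, Real.pow_rpow_inv_natCast hu (by lia)]
  refine tendsto_order.2 ⟨fun a ha => ?_, fun a ha => ?_⟩
  · obtain ⟨u, hau, huγ⟩ := exists_between (max_lt ha hγ)
    obtain ⟨hau, hu⟩ := max_lt_iff.1 hau
    filter_upwards [hlower u hu huγ, eventually_ne_atTop 0] with n hle hn
    calc a < (u ^ (2 * n)) ^ (1 / (2 * (n : ℝ))) := (hroot hu.le hn).symm ▸ hau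
      _ ≤ s n ^ (1 / (2 * (n : ℝ))) := by gcongr
  · obtain ⟨v, hγv, hva⟩ := exists_between ha
    filter_upwards [hupper v hγv, hlower (γ / 2) (half_pos hγ) (half_lt_self hγ),
      eventually_ne_atTop 0] with n hle hpos hn
    have hs : 0 ≤ s n := (by positivity : 0 ≤ (γ / 2) ^ (2 * n)).trans hpos
    calc s n ^ (1 / (2 * (n : ℝ))) ≤ (v ^ (2 * n)) ^ (1 / (2 * (n : ℝ))) := by gcongr
      _ < a := (hroot (hγ.trans hγv).le hn).symm ▸ hva

variable {Γ : Type*} [Group Γ] {Y : Finset Γ} {q : ℕ}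

theorem eventually_twoNorm_hSeq_le (hq : q ≠ 0) (hY : Y.card = q + 1) {v : ℝ}
    (hv : growthRate q Y < v) : ∀ᶠ n in atTop, twoNorm (hSeq Y n) ≤ v ^ n := by
  have hγ : 0 < growthRate q Y := zero_lt_one.trans_le (one_le_growthRate hq hY)
  have hsmall := (isLittleO_pow_const_mul_const_pow_const_pow_of_norm_lt 2
    (show ‖growthRate q Y‖ < v by rwa [Real.norm_of_nonneg hγ.le])).bound
      (show (0 : ℝ) < 1 / 8 by norm_num)
  filter_upwards [hsmall, eventually_ge_atTop 1] with n hle hn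
  rw [Real.norm_of_nonneg (by positivity),
    Real.norm_of_nonneg (pow_nonneg (hγ.trans hv).le n)] at hle
  have hn' : (1 : ℝ) ≤ n := mod_cast hn
  calc twoNorm (hSeq Y n) ≤ 2 * (n + 1) ^ 2 * growthRate q Y ^ n :=
        (twoNorm_le_opNorm _).trans (opNorm_hSeq_le hq hY n)
    _ ≤ 2 * (2 * n) ^ 2 * growthRate q Y ^ n := by gcongr; linarith
    _ = 8 * (n ^ 2 * growthRate q Y ^ n) := by ring
    _ ≤ v ^ n := by linarith

theorem eventually_le_zeta (hq : 2 ≤ q) (hY : Y.card = q + 1) (hL : ¬ IsLeinert Y) {u : ℝ}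
    (hu : 0 < u) (huγ : u < growthRate q Y) : ∀ᶠ n in atTop, u ^ (2 * n) ≤ zeta Y n := by
  obtain ⟨r, hqr, hr, hur⟩ :=
    exists_lt_largerRoot (four_mul_lt_opNorm_sumElt_sq hq hY hL) huγ
  have hqr' : (q : ℝ) < largerRoot q r ^ 2 :=
    (Real.sqrt_lt' (hu.trans hur)).1 (sqrt_lt_largerRoot q.cast_nonneg hqr)
  obtain ⟨c, hc, hle⟩ := exists_le_zeta (by lia) hY hqr.le hr
  have hsmall := ((isLittleO_pow_pow_of_lt_left (sq_nonneg u)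
    (pow_lt_pow_left₀ hur hu.le two_ne_zero)).add
      ((isLittleO_pow_pow_of_lt_left q.cast_nonneg hqr').const_mul_left 2)).bound hc
  filter_upwards [hsmall, eventually_ne_atTop 0] with n hn hn₀
  rw [Real.norm_of_nonneg (by positivity), Real.norm_of_nonneg (by positivity), ← pow_mul,
    ← pow_mul] at hn
  linarith [hle n hn₀]

theorem tendsto_rpow_growthRate (hq : 2 ≤ q) (hY : Y.card = q + 1) (hL : ¬ IsLeinert Y)
    {s : ℕ → ℝ} (hzeta : ∀ n, n ≠ 0 → zeta Y n ≤ s n)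
    (htwoNorm : ∀ n, n ≠ 0 → s n ≤ twoNorm (hSeq Y n) ^ 2) :
    Tendsto (fun n : ℕ => s n ^ (1 / (2 * (n : ℝ)))) atTop (𝓝 (growthRate q Y)) := by
  have hq₀ : q ≠ 0 := by lia
  refine tendsto_rpow_one_div_two_mul (zero_lt_one.trans_le (one_le_growthRate hq₀ hY)) ?_ ?_
  · intro v hv
    filter_upwards [eventually_twoNorm_hSeq_le hq₀ hY hv, eventually_ne_atTop 0] with n hle hn
    rw [mul_comm, pow_mul]
    exact (htwoNorm n hn).trans (pow_le_pow_left₀ (twoNorm_nonneg _) hle 2)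
  · intro u hu huγ
    filter_upwards [eventually_le_zeta hq hY hL hu huγ, eventually_ne_atTop 0] with n hle hn
    exact hle.trans (hzeta n hn)

theorem sq_rpow_one_div_two_mul {x : ℝ} (hx : 0 ≤ x) (y : ℝ) :
    (x ^ 2) ^ (1 / (2 * y)) = x ^ (1 / y) := by
  rw [← Real.rpow_natCast_mul hx]
  congr 1
  push_cast
  rw [one_div, mul_inv, mul_inv_cancel_left₀ two_ne_zero, one_div]

end Limits

end Cogrowth

end

theorem theorem6 {Γ : Type*} [Group Γ] (Y : Finset Γ) (q : ℕ) (hq : 1 ≤ q)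
    (hY : Y.card = q + 1) (γ : ℝ)
    (hγ : γ = 1 / 2 * (Cogrowth.opNorm (Cogrowth.sumElt Y) +
      √(Cogrowth.opNorm (Cogrowth.sumElt Y) ^ 2 - 4 * (q : ℝ)))) :
    (√(q : ℝ) ≤ γ ∧ γ ≤ (q : ℝ) ∧ γ + (q : ℝ) / γ = Cogrowth.opNorm (Cogrowth.sumElt Y)) ∧
    (¬ Cogrowth.IsLeinert Y → 2 ≤ q →
      √(q : ℝ) < γ ∧
      Tendsto (fun n : ℕ => Cogrowth.twoNorm (Cogrowth.hSeq Y n) ^ (1 / (n : ℝ))) atTop (𝓝 γ) ∧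
      Tendsto (fun n : ℕ => Cogrowth.xi Y n ^ (1 / (2 * (n : ℝ)))) atTop (𝓝 γ) ∧
      Tendsto (fun n : ℕ => Cogrowth.eta Y n ^ (1 / (2 * (n : ℝ)))) atTop (𝓝 γ) ∧
      Tendsto (fun n : ℕ => Cogrowth.zeta Y n ^ (1 / (2 * (n : ℝ)))) atTop (𝓝 γ)) := by
  open Cogrowth in
  obtain rfl : γ = growthRate q Y := by rw [hγ, growthRate_eq]
  have hq₀ : q ≠ 0 := by lia
  refine ⟨⟨sqrt_le_growthRate hq₀ hY, growthRate_le hq₀ hY, growthRate_add_div hq₀ hY⟩,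
    fun hL hq₂ => ⟨sqrt_lt_growthRate hq₂ hY hL, ?_⟩⟩
  have hζη (n : ℕ) (hn : n ≠ 0) : zeta Y n ≤ eta Y n := zeta_le_eta Y hn
  have hηξ (n : ℕ) (hn : n ≠ 0) : eta Y n ≤ xi Y n := eta_le_xi hY hn
  have hξh (n : ℕ) (_ : n ≠ 0) : xi Y n ≤ twoNorm (hSeq Y n) ^ 2 := xi_le_twoNorm_sq hY n
  have hζξ (n : ℕ) (hn : n ≠ 0) : zeta Y n ≤ xi Y n := (hζη n hn).trans (hηξ n hn)
  have hηh (n : ℕ) (hn : n ≠ 0) : eta Y n ≤ twoNorm (hSeq Y n) ^ 2 := (hηξ n hn).trans (hξh n hn)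
  refine ⟨?_, tendsto_rpow_growthRate hq₂ hY hL hζξ hξh,
    tendsto_rpow_growthRate hq₂ hY hL hζη hηh,
    tendsto_rpow_growthRate hq₂ hY hL (fun _ _ => le_rfl) fun n hn => (hζη n hn).trans (hηh n hn)⟩
  simpa only [sq_rpow_one_div_two_mul (twoNorm_nonneg _)] using tendsto_rpow_growthRate hq₂ hY hL
    (fun n hn => (hζξ n hn).trans (hξh n hn)) fun _ _ => le_rfl
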